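/- **Notation.** All systems are finite-dimensional. A quantum channel is a completely positive, trace-preserving linear map, and $\sigma_0=I$, $(\sigma_1,\sigma_2,\sigma_3)=(X,Y,Z)$ are the Pauli matrices. The von Neumann entropy is $S(\rho)=-\operatorname{Tr}[\rho\log_2\rho]$. For a channel $\mathcal C$ from $A$ to $B$ the coherent information is $I_c(\mathcal C)=\max_\rho\,[S(\tau_B)-S(\tau_{AB})]$, where $\rho$ ranges over the states of $H_A\otimes H_A$, $\tau_{AB}=(\mathcal I_A\otimes\mathcal C)(\rho)$ and $\tau_B=\operatorname{Tr}_A\tau_{AB}$. The quantum capacity is $Q(\mathcal C)=\lim_{n\to\infty} I_c(\mathcal C^{\otimes n})/n$; a statement $Q(\mathcal C)=c$ includes that all these maxima are attained and that the limit exists. The two-way assisted quantum capacity $Q_{\leftrightarrow}(\mathcal C)$ is the supremum of the rates $R$ such that, for every $\varepsilon>0$ and all large $n$, some protocol consisting of finitely many local operations and measurements, free classical communication in both directions and at most $n$ uses of $\mathcal C$ transfers every pure state of some system of dimension at least $2^{nR}$ from sender to receiver with fidelity at least $1-\varepsilon$. A channel is entanglement-breaking if, applied to one half of any bipartite state, it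 yields a separable state. For channels $\mathcal E,\mathcal F$ from a system to itself with Kraus operators $\{E_i\}$, $\{F_j\}$, and a state $\omega$ of a control qubit, the quantum SWITCH gives the channel $$\mathcal S_\omega(\mathcal E,\mathcal F)(\rho)=\sum_{i,j}K_{ij}(\rho\otimes\omega)K_{ij}^\dagger,\qquad K_{ij}=E_iF_j\otimes|0\rangle\langle 0|+F_jE_i\otimes|1\rangle\langle 1|.$$ All statements about switched channels below hold for every choice of (finite) Kraus representations of the two channels. Write $|\pm\rangle=(|0\rangle\pm|1\rangle)/\sqrt2$. **1. SWITCH of two Pauli channels.** Let $p=(p_0,p_1,p_2,p_3)$ be a probability vector. Then $\mathcal E_p(\rho)=\sum_i p_i\,\sigma_i\rho\,\sigma_i^\dagger$ is a channel with Kraus operators $\sqrt{p_i}\,\sigma_i$. Put $q_-=2(p_1p_2+p_2p_3+p_3p_1)$ and $q_+=1-q_-$. Then $q_-\ge 0$, $q_+>0$, and for every state $\omega$ the map $\mathcal S_\omega(\mathcal E_p,\mathcal E_p)$ is a channel with $$\mathcal S_\omega(\mathcal E_p,\mathcal E_p)(\rho)=q_+\,\mathcal C_+(\rho)\otimes\omega+q_-\,\mathcal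 C_-(\rho)\otimes Z\omega Z,$$ where $$\mathcal C_+(\rho)=\frac{(p_0^2+p_1^2+p_2^2+p_3^2)\,\rho+2p_0\,(p_1X\rho X+p_2Y\rho Y+p_3Z\rho Z)}{q_+}$$ is a channel and $$\mathcal C_-(\rho)=\frac{2p_1p_2\,Z\rho Z+2p_2p_3\,X\rho X+2p_1p_3\,Y\rho Y}{q_-}$$ is a channel if $q_-\neq 0$ (if $q_-=0$ the second term of the sum is zero). **2. The channel $\mathcal E_{XY}$.** Let $\mathcal E_{XY}(\rho)=\frac12(X\rho X+Y\rho Y)$, the Pauli channel with $p=(0,\frac12,\frac12,0)$. It has the measure-and-reprepare form $\mathcal E_{XY}(\rho)=|1\rangle\langle1|\,\langle0|\rho|0\rangle+|0\rangle\langle0|\,\langle1|\rho|1\rangle$. It is an entanglement-breaking channel, and it cannot transmit quantum information: $Q(\mathcal E_{XY})=0$; moreover $Q(\mathcal R\circ\mathcal E_{XY}^{\otimes m}\circ\mathcal T)=0$ for every $m\geq 0$ and all channels $\mathcal T$ from a nonzero system into $m$ qubits and $\mathcal R$ from $m$ qubits into any system (so parallel and sequential uses do not help); and $Q_{\leftrightarrow}(\mathcal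 E_{XY})=0$. **3. Perfect activation.** Let $\mathcal S=\mathcal S_{|+\rangle\langle+|}(\mathcal E_{XY},\mathcal E_{XY})$. Then $$\mathcal S(\rho)=\tfrac12\,\rho\otimes|+\rangle\langle+|+\tfrac12\,Z\rho Z\otimes|-\rangle\langle-|.$$ When the control is measured in the basis $\{|+\rangle,|-\rangle\}$, the unnormalised conditional states of the system are $\langle+|\mathcal S(\rho)|+\rangle=\frac12\rho$ and $\langle-|\mathcal S(\rho)|-\rangle=\frac12Z\rho Z$. Let $\mathcal M$ be the map that measures the control of $\mathcal S(\rho)$ in this basis and gives the system and the classical outcome to the receiver. Then $\mathcal M$ is a channel and is a perfect qubit channel: there is a channel $\mathcal R$ with $\mathcal R\circ\mathcal M=\mathcal I$. Furthermore $Q(\mathcal S)=1$ and $Q(\mathcal M)=1$. This is the largest possible value for a qubit input: for every channel $\mathcal C$ from a qubit to a finite-dimensional system, if the quantum capacity $Q(\mathcal C)$ exists in the above sense, then $Q(\mathcal C)\le1$. -/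

import Mathlib

open scoped Kronecker Matrix ComplexOrder

noncomputable section

/-! Finite-dimensional systems are indexed by finite types; operators are complex matrices. -/

/-- Linear maps from operators on the system `a` to operators on the system `b`. -/
abbrev OpMap (a b : Type*) : Type _ := Matrix a a ℂ →ₗ[ℂ] Matrix b b ℂ

/-- Density operators: positive semidefinite with unit trace. -/
def IsDensity {a : Type*} [Fintype a] (ρ : Matrix a a ℂ) : Prop :=
  ρ.PosSemidef ∧ ρ.trace = 1

/-- The projector `|v⟩⟨v|`. -/
def ketbra {a : Type*} (v : a → ℂ) : Matrix a a ℂ := Matrix.vecMulVec v (star v)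

/-- The map `ρ ↦ K ρ Kᴴ`. -/
def conjMap {a b : Type*} [Fintype a] (K : Matrix b a ℂ) : OpMap a b where
  toFun ρ := K * ρ * Kᴴ
  map_add' ρ σ := by rw [Matrix.mul_add, Matrix.add_mul]
  map_smul' c ρ := by simp

/-- The map `I_k ⊗ Φ`, acting blockwise: the block `(i, j)` of `ρ` is mapped by `Φ`. -/
def ampliation (k : Type*) {a b : Type*} (Φ : OpMap a b) : OpMap (k × a) (k × b) where
  toFun ρ := Matrix.of fun p q =>
    Φ (Matrix.of fun x y => ρ (p.1, x) (q.1, y)) p.2 q.2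
  map_add' ρ σ := by
    ext p q
    have h : (Matrix.of fun x y => (ρ + σ) (p.1, x) (q.1, y)) =
        (Matrix.of fun x y => ρ (p.1, x) (q.1, y)) +
          (Matrix.of fun x y => σ (p.1, x) (q.1, y)) := rfl
    simp only [Matrix.of_apply, Matrix.add_apply]
    simp only [Matrix.add_apply] at h
    rw [h, map_add, Matrix.add_apply]
  map_smul' c ρ := by
    ext p q
    have h : (Matrix.of fun x y => (c • ρ) (p.1, x) (q.1, y)) =
        c • (Matrix.of fun x y => ρ (p.1, x) (q.1, y)) := rfl
    simp only [Matrix.of_apply, Matrix.smul_apply, RingHom.id_apply]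
    simp only [Matrix.smul_apply] at h
    rw [h, map_smul, Matrix.smul_apply]

/-- The map `Φ ⊗ ⋯ ⊗ Φ` (`n` factors), given by its values on products of matrix units. -/
def tensorPower {a b : Type*} [Fintype a] [DecidableEq a] (Φ : OpMap a b) (n : ℕ) :
    OpMap (Fin n → a) (Fin n → b) where
  toFun ρ := Matrix.of fun x y =>
    ∑ i, ∑ j, ρ i j * ∏ k, Φ (Matrix.single (i k) (j k) 1) (x k) (y k)
  map_add' ρ σ := by
    ext x y
    simp [add_mul, Finset.sum_add_distrib]
  map_smul' c ρ := by
    ext x y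
    simp [Finset.mul_sum, mul_assoc]

/-- Quantum channels: completely positive, trace-preserving linear maps. -/
structure IsChannel {a b : Type*} [Fintype a] [Fintype b] (Φ : OpMap a b) : Prop where
  completelyPositive : ∀ (k : ℕ) (ρ : Matrix (Fin k × a) (Fin k × a) ℂ),
    ρ.PosSemidef → (ampliation (Fin k) Φ ρ).PosSemidef
  tracePreserving : ∀ ρ : Matrix a a ℂ, (Φ ρ).trace = ρ.trace

/-- The operators `K 0, …, K (r - 1)` form a Kraus representation of the channel `Φ`. -/
structure IsKrausRep {a b : Type*} [Fintype a] [DecidableEq a] [Fintype b] {r : ℕ}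
    (K : Fin r → Matrix b a ℂ) (Φ : OpMap a b) : Prop where
  complete : ∑ i, (K i)ᴴ * K i = 1
  apply_eq : ∀ ρ, Φ ρ = ∑ i, K i * ρ * (K i)ᴴ

/-! ### Entropy, coherent information, quantum capacity -/

/-- Von Neumann entropy `- Tr [ρ log₂ ρ]` (with `0 log 0 = 0`). -/
def vonNeumannEntropy {a : Type*} [Fintype a] [DecidableEq a] (ρ : Matrix a a ℂ) : ℝ :=
  -(ρ * cfc (Real.logb 2) ρ).trace.re

/-- Partial trace over the first factor. -/
def traceFst {a b : Type*} [Fintype a] (σ : Matrix (a × b) (a × b) ℂ) : Matrix b b ℂ :=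
  Matrix.of fun x y => ∑ i, σ (i, x) (i, y)

/-- Coherent information `I_c(A⟩B)_σ = S(σ_B) - S(σ_AB)` of a bipartite state. -/
def stateCoherentInfo {a b : Type*} [Fintype a] [DecidableEq a] [Fintype b] [DecidableEq b]
    (σ : Matrix (a × b) (a × b) ℂ) : ℝ :=
  vonNeumannEntropy (traceFst σ) - vonNeumannEntropy σ

/-- `c` is the coherent information of the channel `Φ`, that is, the maximum of
`I_c(A⟩B)` at `(I_A ⊗ Φ)(ρ)` over the states `ρ` of two copies of the input system. -/
def HasCoherentInfo {a b : Type*} [Fintype a] [DecidableEq a] [Fintype b] [DecidableEq b]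
    (Φ : OpMap a b) (c : ℝ) : Prop :=
  IsGreatest {x : ℝ | ∃ ρ : Matrix (a × a) (a × a) ℂ,
    IsDensity ρ ∧ x = stateCoherentInfo (ampliation a Φ ρ)} c

/-- The quantum capacity of `Φ` exists and is `Q = lim I_c(Φ^{⊗ n}) / n`. -/
def HasQuantumCapacity {a b : Type*} [Fintype a] [DecidableEq a] [Fintype b] [DecidableEq b]
    (Φ : OpMap a b) (Q : ℝ) : Prop :=
  ∃ c : ℕ → ℝ, (∀ n, HasCoherentInfo (tensorPower Φ n) (c n)) ∧
    Filter.Tendsto (fun n : ℕ => c n / n) Filter.atTop (nhds Q)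

/-! ### Separability -/

/-- Separable states: finite convex combinations of product states. -/
def IsSeparableState {a b : Type*} [Fintype a] [Fintype b]
    (σ : Matrix (a × b) (a × b) ℂ) : Prop :=
  ∃ (r : ℕ) (q : Fin r → ℝ) (α : Fin r → Matrix a a ℂ) (β : Fin r → Matrix b b ℂ),
    q ∈ stdSimplex ℝ (Fin r) ∧ (∀ i, IsDensity (α i)) ∧ (∀ i, IsDensity (β i)) ∧
      σ = ∑ i, (q i : ℂ) • (α i ⊗ₖ β i)

/-- Entanglement-breaking channels: applied to one half of any bipartite state, they yield a
separable state. -/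
def IsEntanglementBreaking {a b : Type*} [Fintype a] [Fintype b] (Φ : OpMap a b) : Prop :=
  IsChannel Φ ∧ ∀ (k : ℕ) (ρ : Matrix (Fin k × a) (Fin k × a) ℂ),
    IsDensity ρ → IsSeparableState (ampliation (Fin k) Φ ρ)

/-- `Φ` is perfectly correctable: some channel `R` satisfies `R ∘ Φ = id`. -/
def IsCorrectable {a b : Type*} [Fintype a] [Fintype b] (Φ : OpMap a b) : Prop :=
  ∃ R : OpMap b a, IsChannel R ∧ R ∘ₗ Φ = LinearMap.id

/-! ### Two-way classical assistance -/

/-- One use of the qubit channel `E`: the sender, holding `a` dimensions and a qubit, sends the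
qubit through `E` to the receiver, who holds `b` dimensions and now also gets the output. -/
def sendQubit (E : OpMap (Fin 2) (Fin 2)) (a b : ℕ) :
    OpMap (Fin (a * 2) × Fin b) (Fin a × Fin (b * 2)) where
  toFun τ := Matrix.of fun p q =>
    ampliation (Fin a × Fin b) E
      (τ.submatrix (fun z : (Fin a × Fin b) × Fin 2 => (finProdFinEquiv (z.1.1, z.2), z.1.2))
        (fun z : (Fin a × Fin b) × Fin 2 => (finProdFinEquiv (z.1.1, z.2), z.1.2)))
      ((p.1, (finProdFinEquiv.symm p.2).1), (finProdFinEquiv.symm p.2).2)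
      ((q.1, (finProdFinEquiv.symm q.2).1), (finProdFinEquiv.symm q.2).2)
  map_add' τ υ := by
    ext p q
    simp only [Matrix.submatrix_add, Pi.add_apply, map_add, Matrix.add_apply, Matrix.of_apply]
  map_smul' c τ := by
    ext p q
    simp only [Matrix.submatrix_smul, Pi.smul_apply, map_smul, Matrix.smul_apply,
      Matrix.of_apply, RingHom.id_apply]

/-- `TwoWayProtocol E n a b a' b' Φ`: the map `Φ` from operators of the sender (dimension `a`)
and the receiver (dimension `b`) to operators of the sender (`a'`) and the receiver (`b'`) is
implemented by finitely many local measurements and operations, whose outcomes are announced to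
the other party, and at most `n` uses of `E` from the sender to the receiver. -/
inductive TwoWayProtocol (E : OpMap (Fin 2) (Fin 2)) :
    (n a b a' b' : ℕ) → OpMap (Fin a × Fin b) (Fin a' × Fin b') → Prop
  /-- Stop. -/
  | done (n a b : ℕ) : TwoWayProtocol E n a b a b LinearMap.id
  /-- The sender measures with operators `A k`, announces `k`, and protocol `Φ k` follows. -/
  | sender {n a b a₁ a' b' r : ℕ} (A : Fin r → Matrix (Fin a₁) (Fin a) ℂ)
      (hA : ∑ k, (A k)ᴴ * A k = 1) (Φ : Fin r → OpMap (Fin a₁ × Fin b) (Fin a' × Fin b'))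
      (hΦ : ∀ k, TwoWayProtocol E n a₁ b a' b' (Φ k)) :
      TwoWayProtocol E n a b a' b'
        (∑ k, Φ k ∘ₗ conjMap (A k ⊗ₖ (1 : Matrix (Fin b) (Fin b) ℂ)))
  /-- The receiver measures with operators `B k`, announces `k`, and protocol `Φ k` follows. -/
  | receiver {n a b b₁ a' b' r : ℕ} (B : Fin r → Matrix (Fin b₁) (Fin b) ℂ)
      (hB : ∑ k, (B k)ᴴ * B k = 1) (Φ : Fin r → OpMap (Fin a × Fin b₁) (Fin a' × Fin b'))
      (hΦ : ∀ k, TwoWayProtocol E n a b₁ a' b' (Φ k)) :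
      TwoWayProtocol E n a b a' b'
        (∑ k, Φ k ∘ₗ conjMap ((1 : Matrix (Fin a) (Fin a) ℂ) ⊗ₖ B k))
  /-- The sender uses the channel `E` once, and protocol `Φ` follows. -/
  | use {n a b a' b' : ℕ} (Φ : OpMap (Fin a × Fin (b * 2)) (Fin a' × Fin b'))
      (hΦ : TwoWayProtocol E n a (b * 2) a' b' Φ) :
      TwoWayProtocol E (n + 1) (a * 2) b a' b' (Φ ∘ₗ sendQubit E a b)

/-- The rate `R` is achievable with two-way classical assistance: for every `ε > 0` and all
large `n`, some protocol with at most `n` uses of `E` transfers every pure state of some system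
of dimension `D ≥ 2 ^ (n R)` from the sender to the receiver with fidelity at least `1 - ε`. -/
def IsTwoWayAchievable (E : OpMap (Fin 2) (Fin 2)) (R : ℝ) : Prop :=
  ∀ ε : ℝ, 0 < ε → ∃ N : ℕ, ∀ n : ℕ, N ≤ n →
    ∃ (D : ℕ) (Φ : OpMap (Fin D × Fin 1) (Fin 1 × Fin D)),
      (2 : ℝ) ^ ((n : ℝ) * R) ≤ (D : ℝ) ∧ TwoWayProtocol E n D 1 1 D Φ ∧
      ∀ ψ : Fin D → ℂ, star ψ ⬝ᵥ ψ = 1 →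
        1 - ε ≤ (star (fun z : Fin 1 × Fin D => ψ z.2) ⬝ᵥ
          (Φ (ketbra fun z : Fin D × Fin 1 => ψ z.1) *ᵥ fun z => ψ z.2)).re

/-- `Q` is the quantum capacity of `E` assisted by two-way classical communication. -/
def HasTwoWayQuantumCapacity (E : OpMap (Fin 2) (Fin 2)) (Q : ℝ) : Prop :=
  IsLUB {R : ℝ | IsTwoWayAchievable E R} Q

/-! ### The quantum SWITCH -/

/-- The Kraus operators `E_i F_j ⊗ |0⟩⟨0| + F_j E_i ⊗ |1⟩⟨1|` of the quantum SWITCH. -/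
def switchKraus {d : Type*} [Fintype d] {r s : ℕ} (E : Fin r → Matrix d d ℂ)
    (F : Fin s → Matrix d d ℂ) (i : Fin r) (j : Fin s) :
    Matrix (d × Fin 2) (d × Fin 2) ℂ :=
  (E i * F j) ⊗ₖ Matrix.single 0 0 1 + (F j * E i) ⊗ₖ Matrix.single 1 1 1

/-- The switched channel `S_ω(E, F)`, from the system to the system and the control qubit,
for the channels with Kraus operators `E i` and `F j`. -/
def switchMap {d : Type*} [Fintype d] {r s : ℕ} (E : Fin r → Matrix d d ℂ)
    (F : Fin s → Matrix d d ℂ) (ω : Matrix (Fin 2) (Fin 2) ℂ) : OpMap d (d × Fin 2) where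
  toFun ρ := ∑ i, ∑ j, switchKraus E F i j * (ρ ⊗ₖ ω) * (switchKraus E F i j)ᴴ
  map_add' ρ σ := by
    simp only [Matrix.add_kronecker, Matrix.mul_add, Matrix.add_mul, Finset.sum_add_distrib]
  map_smul' c ρ := by
    simp only [Matrix.smul_kronecker, Matrix.mul_smul, Matrix.smul_mul, Finset.smul_sum,
      RingHom.id_apply]

/-- The vectors `|+⟩` (index `0`) and `|-⟩` (index `1`). -/
def fourierKet : Fin 2 → Fin 2 → ℂ :=
  ![![((√2 : ℝ) : ℂ)⁻¹, ((√2 : ℝ) : ℂ)⁻¹], ![((√2 : ℝ) : ℂ)⁻¹, -((√2 : ℝ) : ℂ)⁻¹]]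

/-- The unnormalised state `(I ⊗ ⟨v|) τ (I ⊗ |v⟩)` of the system when a measurement of the
control projects it on `|v⟩`; its trace is the probability of this outcome. -/
def controlOutcome {d : Type*} (v : Fin 2 → ℂ) : OpMap (d × Fin 2) d where
  toFun τ := Matrix.of fun x y => ∑ c, ∑ c', star (v c) * τ (x, c) (y, c') * v c'
  map_add' τ υ := by
    ext x y
    simp [mul_add, add_mul, Finset.sum_add_distrib]
  map_smul' t τ := by
    ext x y
    simp [mul_assoc, mul_left_comm]
    ring

/-- The map obtained from `Φ` when the control qubit is measured in the basis `|+⟩, |-⟩` and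
the outcome is given to the receiver in a classical register. -/
def measureControl {a d : Type*} (Φ : OpMap a (d × Fin 2)) : OpMap a (d × Fin 2) where
  toFun ρ := ∑ s, controlOutcome (fourierKet s) (Φ ρ) ⊗ₖ Matrix.single s s 1
  map_add' ρ σ := by
    simp only [map_add, Matrix.add_kronecker, Finset.sum_add_distrib]
  map_smul' c ρ := by
    simp only [map_smul, Matrix.smul_kronecker, Finset.smul_sum, RingHom.id_apply]

/-! ### Pauli channels -/

/-- The identity and the Pauli matrices `X`, `Y`, `Z`. -/
def pauli : Fin 4 → Matrix (Fin 2) (Fin 2) ℂ :=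
  ![1, !![0, 1; 1, 0], !![0, -Complex.I; Complex.I, 0], !![1, 0; 0, -1]]

/-- The Pauli channel `ρ ↦ ∑ i, p_i σ_i ρ σ_iᴴ`. -/
def pauliChannel (p : Fin 4 → ℝ) : OpMap (Fin 2) (Fin 2) :=
  ∑ i, (p i : ℂ) • conjMap (pauli i)

/-- The Kraus operators `√p_i σ_i` of the Pauli channel. -/
def pauliKraus (p : Fin 4 → ℝ) (i : Fin 4) : Matrix (Fin 2) (Fin 2) ℂ :=
  ((√(p i) : ℝ) : ℂ) • pauli i

/-- The channel `ρ ↦ (X ρ X + Y ρ Y) / 2`. -/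
def channelXY : OpMap (Fin 2) (Fin 2) :=
  (1 / 2 : ℂ) • (conjMap (pauli 1) + conjMap (pauli 2))

/-- The probability `q₋ = 2 (p₁ p₂ + p₂ p₃ + p₃ p₁)`. -/
def qMinus (p : Fin 4 → ℝ) : ℝ := 2 * (p 1 * p 2 + p 2 * p 3 + p 3 * p 1)

/-- The probability `q₊ = 1 - q₋`. -/
def qPlus (p : Fin 4 → ℝ) : ℝ := 1 - qMinus p

/-- The map `C₊`. -/
def cPlus (p : Fin 4 → ℝ) : OpMap (Fin 2) (Fin 2) :=
  ((qPlus p)⁻¹ : ℂ) •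
    (((p 0 ^ 2 + p 1 ^ 2 + p 2 ^ 2 + p 3 ^ 2 : ℝ) : ℂ) • LinearMap.id +
      (2 * p 0 : ℂ) • ((p 1 : ℂ) • conjMap (pauli 1) + (p 2 : ℂ) • conjMap (pauli 2) +
        (p 3 : ℂ) • conjMap (pauli 3)))

/-- The map `C₋` (meaningful when `q₋ ≠ 0`). -/
def cMinus (p : Fin 4 → ℝ) : OpMap (Fin 2) (Fin 2) :=
  ((qMinus p)⁻¹ : ℂ) •
    ((2 * p 1 * p 2 : ℂ) • conjMap (pauli 3) + (2 * p 2 * p 3 : ℂ) • conjMap (pauli 1) +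
      (2 * p 1 * p 3 : ℂ) • conjMap (pauli 2))

end

section

open Matrix

/-! The SWITCH has a control-diagonal part, where the channels act one after the other, and
off-diagonal blocks in which the order differs on the two sides of the state. Pauli matrices commute
or anticommute, and distinct nontrivial ones anticommute, so their contribution `q₋ C₋` enters the
diagonal blocks with a plus sign and the off-diagonal ones with a minus sign. Conjugating the
control by `Z` produces exactly these signs. The blocks do not depend on the Kraus representations,
because sums over one family can be folded back into the channel (`switchMap_apply_eq`,
`switchMap_pauliChannel`).

All upper bounds on coherent information come from `stateCoherentInfo_le`: `τ ≤ c (1 ⊗ τ_B)` implies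
`S(B) - S(AB) ≤ log₂ c`. Rank-one Kraus operators give `c = 1` (the reduction criterion), and rank
one survives tensor powers and composition with any channel on either side; hence zero capacity for
`channelXY` and for all its parallel uses between an encoder and a decoder. An arbitrary channel
satisfies the inequality with `c` the input dimension, by pinching, which bounds a qubit capacity by
one. Complete positivity is exploited through Choi's theorem `IsChannel.isKrausSum`.

For two-way assistance, one use of `channelXY` is itself a local measurement and preparation, so
every protocol is a trace-preserving sum of maps with Kraus operators `A ⊗ B`. Between a sender who
ends with dimension one and a receiver who starts with dimension one, such a map measures and
prepares; on the four states of two mutually unbiased bases of a plane its average fidelity is at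
most `3/4`, so no positive rate is achievable.

For activation, `q₊ = q₋ = 1/2`, `C₊` is the identity, `C₋` is conjugation by `Z`, and the control
flags the two cases by orthogonal states. The Choi state and its marginal on the receiver are then
multiples of projections, so both entropies are logarithms, for every tensor power; the coherent
information attains the dimension bound. -/

/-! ### Spectral formulas for the von Neumann entropy -/

theorem Matrix.IsHermitian.exists_diagonalization {a : Type*} [Fintype a] [DecidableEq a]
    {A : Matrix a a ℂ} (hA : A.IsHermitian) :
    ∃ (U : Matrix a a ℂ), Uᴴ * U = 1 ∧ U * Uᴴ = 1 ∧
      A = U * diagonal (fun i => ((hA.eigenvalues i : ℝ) : ℂ)) * Uᴴ := by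
  refine ⟨hA.eigenvectorUnitary, ?_, ?_, ?_⟩
  · rw [← star_eq_conjTranspose]; exact Unitary.coe_star_mul_self _
  · rw [← star_eq_conjTranspose]; exact Unitary.coe_mul_star_self _
  · conv_lhs => rw [hA.spectral_theorem, Unitary.conjStarAlgAut_apply]
    rfl

theorem vonNeumannEntropy_eq_sum_eigenvalues {a : Type*} [Fintype a] [DecidableEq a]
    {ρ : Matrix a a ℂ} (hρ : ρ.IsHermitian) :
    vonNeumannEntropy ρ = (∑ i, Real.negMulLog (hρ.eigenvalues i)) / Real.log 2 := by
  unfold vonNeumannEntropy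
  have h : ρ * cfc (Real.logb 2) ρ = Unitary.conjStarAlgAut ℂ _ hρ.eigenvectorUnitary
      (diagonal fun i => ((hρ.eigenvalues i * Real.logb 2 (hρ.eigenvalues i) : ℝ) : ℂ)) := by
    rw [hρ.cfc_eq, IsHermitian.cfc]
    conv_lhs => enter [1]; rw [hρ.spectral_theorem]
    rw [← map_mul, diagonal_mul_diagonal]
    simp [Function.comp_def]
  rw [h, Unitary.conjStarAlgAut_apply, Matrix.trace_mul_comm, ← mul_assoc]
  simp only [Unitary.coe_star_mul_self, one_mul, trace_diagonal, Complex.re_sum, Complex.ofReal_re]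
  rw [Finset.sum_div, ← Finset.sum_neg_distrib]
  refine Finset.sum_congr rfl fun i _ => ?_
  rw [Real.negMulLog, Real.logb]
  ring

/-- The multiset of eigenvalues is read off from the characteristic polynomial, so any unitary
diagonalization computes the entropy, not only the one chosen by the spectral theorem. -/
theorem vonNeumannEntropy_eq_sum {a : Type*} [Fintype a] [DecidableEq a]
    {ρ U : Matrix a a ℂ} {d : a → ℝ} (hU : Uᴴ * U = 1)
    (h : ρ = U * diagonal (fun i => (d i : ℂ)) * Uᴴ) :
    vonNeumannEntropy ρ = (∑ i, Real.negMulLog (d i)) / Real.log 2 := by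
  have hρ : ρ.IsHermitian := by
    rw [h]
    exact isHermitian_mul_mul_conjTranspose _
      (isHermitian_diagonal_of_self_adjoint _ (funext fun i => Complex.conj_ofReal _))
  rw [vonNeumannEntropy_eq_sum_eigenvalues hρ]
  congr 1
  have h1 : ρ.charpoly.roots = Multiset.map (fun i => (d i : ℂ)) Finset.univ.val := by
    rw [h, charpoly_mul_comm, ← mul_assoc, hU, one_mul, charpoly_diagonal,
      Polynomial.roots_prod _ _ (Finset.prod_ne_zero_iff.2 fun i _ => Polynomial.X_sub_C_ne_zero _)]
    simp [Multiset.bind_singleton]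
  have h2 := hρ.roots_charpoly_eq_eigenvalues
  rw [h1] at h2
  have h3 := congrArg (fun s => (Multiset.map (fun z : ℂ => Real.negMulLog z.re) s).sum) h2
  simpa [Multiset.map_map, Function.comp_def] using h3.symm

/-- Every nonzero eigenvalue equals `c`, so `negMulLog` is linear on the spectrum and the unit trace
finishes the computation. This gives entropies of tensor powers without finding their spectra. -/
theorem vonNeumannEntropy_of_mul_self {a : Type*} [Fintype a] [DecidableEq a]
    {ρ : Matrix a a ℂ} (hρ : ρ.IsHermitian) (ht : ρ.trace = 1) {c : ℝ}
    (h : ρ * ρ = (c : ℂ) • ρ) : vonNeumannEntropy ρ = -Real.logb 2 c := by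
  rw [vonNeumannEntropy_eq_sum_eigenvalues hρ]
  obtain ⟨U, hU, hU', hd⟩ := hρ.exists_diagonalization
  set l := hρ.eigenvalues
  have hD : Uᴴ * ρ * U = diagonal (fun i => (l i : ℂ)) := by
    rw [hd]
    calc Uᴴ * (U * diagonal (fun i => (l i : ℂ)) * Uᴴ) * U
        = (Uᴴ * U) * diagonal (fun i => (l i : ℂ)) * (Uᴴ * U) := by simp only [mul_assoc]
      _ = _ := by rw [hU, one_mul, mul_one]
  have hDD : diagonal (fun i => (l i : ℂ)) * diagonal (fun i => (l i : ℂ))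
      = (c : ℂ) • diagonal (fun i => (l i : ℂ)) := by
    rw [← hD]
    calc Uᴴ * ρ * U * (Uᴴ * ρ * U) = Uᴴ * ρ * (U * Uᴴ) * ρ * U := by simp only [mul_assoc]
      _ = Uᴴ * (ρ * ρ) * U := by rw [hU', mul_one, mul_assoc Uᴴ]
      _ = _ := by rw [h]; simp
  have hl : ∀ i, l i * l i = c * l i := fun i => by
    have := congrFun (congrFun hDD i) i
    simp only [diagonal_mul_diagonal, diagonal_apply_eq, Matrix.smul_apply, smul_eq_mul] at this
    exact_mod_cast this
  have hs : ∑ i, l i = 1 := by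
    have := hρ.trace_eq_sum_eigenvalues
    rw [ht] at this
    have h2 := congrArg Complex.re this
    simpa using h2.symm
  have : ∀ i, Real.negMulLog (l i) = -Real.log c * l i := fun i => by
    rcases eq_or_ne (l i) 0 with h0 | h0
    · simp [h0]
    · have : l i = c := mul_right_cancel₀ h0 (hl i)
      rw [this, Real.negMulLog]; ring
  rw [Finset.sum_congr rfl fun i _ => this i, ← Finset.mul_sum, hs, Real.logb]
  ring

/-- A pure factor only pads the spectrum with zeros, where `negMulLog` vanishes. -/
theorem vonNeumannEntropy_single_kronecker {a b : Type*} [Fintype a] [DecidableEq a] [Fintype b]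
    [DecidableEq b] (i : a) {β : Matrix b b ℂ} (hβ : β.IsHermitian) :
    vonNeumannEntropy (Matrix.single i i (1 : ℂ) ⊗ₖ β) = vonNeumannEntropy β := by
  obtain ⟨U, hU, hU', hd⟩ := hβ.exists_diagonalization
  set l := hβ.eigenvalues
  have h1 : Matrix.single i i (1 : ℂ) ⊗ₖ β = ((1 : Matrix a a ℂ) ⊗ₖ U) *
      diagonal (fun p : a × b => ((if p.1 = i then l p.2 else 0 : ℝ) : ℂ)) *
      ((1 : Matrix a a ℂ) ⊗ₖ U)ᴴ := by
    have : diagonal (fun p : a × b => ((if p.1 = i then l p.2 else 0 : ℝ) : ℂ)) =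
        Matrix.single i i (1 : ℂ) ⊗ₖ diagonal (fun k => (l k : ℂ)) := by
      rw [← diagonal_single, diagonal_kronecker_diagonal]
      congr 1
      ext p
      rcases eq_or_ne p.1 i with h | h <;> simp [h]
    rw [this, conjTranspose_kronecker, ← mul_kronecker_mul, ← mul_kronecker_mul, ← hd]
    simp
  rw [vonNeumannEntropy_eq_sum (U := (1 : Matrix a a ℂ) ⊗ₖ U) (by
    rw [conjTranspose_kronecker, ← mul_kronecker_mul, hU]; simp) h1, vonNeumannEntropy_eq_sum hU hd]
  congr 1
  rw [Fintype.sum_prod_type, Finset.sum_eq_single i]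
  · simp
  · intro j _ hj; simp [hj]
  · simp

/-! ### Coherent information bounded through an operator inequality -/

theorem star_dotProduct_mulVec_diagonalization {a : Type*} [Fintype a] [DecidableEq a]
    {A U : Matrix a a ℂ} {d : a → ℝ} (h : A = U * diagonal (fun i => (d i : ℂ)) * Uᴴ)
    (x : a → ℂ) :
    (star x ⬝ᵥ A *ᵥ x).re = ∑ i, d i * ‖(Uᴴ *ᵥ x) i‖ ^ 2 := by
  have h1 : star x ⬝ᵥ A *ᵥ x =
      star (Uᴴ *ᵥ x) ⬝ᵥ (diagonal (fun i => (d i : ℂ)) *ᵥ (Uᴴ *ᵥ x)) := by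
    rw [h, star_mulVec, conjTranspose_conjTranspose, ← dotProduct_mulVec, mulVec_mulVec,
      mulVec_mulVec]
  rw [h1, dotProduct, Complex.re_sum]
  refine Finset.sum_congr rfl fun i _ => ?_
  rw [mulVec_diagonal, Pi.star_apply, mul_left_comm, RCLike.star_def,
    Complex.conj_mul', ← Complex.ofReal_pow, ← Complex.ofReal_mul, Complex.ofReal_re]

/-- Comparison of two weighted logarithms for operators `diag l` and `diag ν` whose bases are
related by `G`, when the first operator is dominated by the second. -/
theorem sum_mul_log_le_of_form_le {ι κ : Type*} [Fintype ι] [Fintype κ] [DecidableEq κ]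
    {l : ι → ℝ} {ν : κ → ℝ} (hl : ∀ j, 0 ≤ l j) (hν : ∀ k, 0 ≤ ν k) {G : Matrix ι κ ℂ}
    (hG : ∀ j, ∑ k, ‖G j k‖ ^ 2 = 1)
    (H : ∀ y : κ → ℂ, ∑ j, l j * ‖(G *ᵥ y) j‖ ^ 2 ≤ ∑ k, ν k * ‖y k‖ ^ 2) :
    ∑ j, l j * Real.log (l j) ≤ ∑ j, ∑ k, l j * ‖G j k‖ ^ 2 * Real.log (ν k) := by
  refine Finset.sum_le_sum fun j _ => ?_
  rcases (hl j).eq_or_lt with h0 | hpos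
  · simp [← h0]
  have single_le : ∀ y : κ → ℂ, l j * ‖(G *ᵥ y) j‖ ^ 2 ≤ ∑ k, ν k * ‖y k‖ ^ 2 := fun y =>
    (Finset.single_le_sum (f := fun j => l j * ‖(G *ᵥ y) j‖ ^ 2)
      (fun i _ => mul_nonneg (hl i) (sq_nonneg _)) (Finset.mem_univ j)).trans (H y)
  -- Testing on a basis vector shows that row `j` is orthogonal to the kernel of `diag ν`, so the
  -- junk value `log 0 = 0` does no harm.
  have hzero : ∀ k, ν k = 0 → ‖G j k‖ ^ 2 = 0 := fun k hk => by
    have h1 := single_le (Pi.single k 1)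
    have h2 : ∑ i, ν i * ‖(Pi.single k 1 : κ → ℂ) i‖ ^ 2 = 0 := by
      refine Finset.sum_eq_zero fun i _ => ?_
      rcases eq_or_ne i k with rfl | h
      · simp [hk]
      · simp [h]
    rw [h2] at h1
    simp only [mulVec_single_one, col_apply] at h1
    nlinarith [sq_nonneg ‖G j k‖]
  set s := ∑ k, ‖G j k‖ ^ 2 / ν k with hs
  have hs0 : 0 ≤ s := Finset.sum_nonneg fun k _ => div_nonneg (sq_nonneg _) (hν k)
  have hls : l j * s ≤ 1 := by
    -- With `g` the conjugate of row `j` and `s = ⟨g, ν⁻¹ g⟩` (inverse on the support, as `x / 0 =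
    -- 0`), the test vector `ν⁻¹ g` turns the domination into `l j * s ^ 2 ≤ s`.
    have h1 := single_le (fun k => star (G j k) / (ν k : ℂ))
    have h2 : (G *ᵥ fun k => star (G j k) / (ν k : ℂ)) j = (s : ℂ) := by
      simp only [mulVec, dotProduct, hs, Complex.ofReal_sum]
      refine Finset.sum_congr rfl fun k _ => ?_
      rw [← mul_div_assoc, RCLike.star_def, Complex.mul_conj']
      push_cast; rfl
    have h3 : ∑ k, ν k * ‖star (G j k) / (ν k : ℂ)‖ ^ 2 = s := by
      rw [hs]
      refine Finset.sum_congr rfl fun k _ => ?_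
      rw [norm_div, norm_star, Complex.norm_real, Real.norm_of_nonneg (hν k), div_pow]
      rcases eq_or_ne (ν k) 0 with h | h
      · simp [h]
      · field_simp
    rw [h2, h3, Complex.norm_real, Real.norm_of_nonneg hs0] at h1
    rcases hs0.eq_or_lt with h | h
    · rw [← h]; simp
    · have : l j * s * s ≤ 1 * s := by nlinarith
      exact le_of_mul_le_mul_right this h
  -- This is `log x ≥ 1 - 1/x` at `x = ν k / l j`. Averaged with the weights `‖G j k‖ ^ 2`, the left
  -- side becomes `1 - l j * s ≥ 0`; operator monotonicity of the logarithm is not needed.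
  have key : ∀ k, ‖G j k‖ ^ 2 - l j * (‖G j k‖ ^ 2 / ν k) ≤
      ‖G j k‖ ^ 2 * (Real.log (ν k) - Real.log (l j)) := fun k => by
    rcases (hν k).eq_or_lt with h | h
    · simp [hzero k h.symm]
    · have h1 := Real.one_sub_inv_le_log_of_pos (div_pos h hpos)
      rw [Real.log_div h.ne' hpos.ne', inv_div] at h1
      have := mul_le_mul_of_nonneg_left h1 (sq_nonneg ‖G j k‖)
      calc _ = ‖G j k‖ ^ 2 * (1 - l j / ν k) := by ring
        _ ≤ _ := this
  have h2 := Finset.sum_le_sum fun k (_ : k ∈ Finset.univ) => key k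
  simp only [mul_sub, Finset.sum_sub_distrib, ← Finset.mul_sum, ← Finset.sum_mul, hG, ← hs] at h2
  simp only [mul_assoc, ← Finset.mul_sum]
  exact mul_le_mul_of_nonneg_left (by linarith) hpos.le

theorem traceFst_conj_one_kronecker {a b : Type*} [Fintype a] [DecidableEq a] [Fintype b]
    (U V : Matrix b b ℂ) (τ : Matrix (a × b) (a × b) ℂ) :
    traceFst (((1 : Matrix a a ℂ) ⊗ₖ U) * τ * ((1 : Matrix a a ℂ) ⊗ₖ V)) =
      U * traceFst τ * V := by
  ext x y
  simp only [traceFst, of_apply, mul_apply, Fintype.sum_prod_type, kroneckerMap_apply, one_apply,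
    Finset.sum_mul, Finset.mul_sum, ite_mul, one_mul, zero_mul, mul_ite, mul_zero]
  simp only [Finset.sum_ite_irrel, Finset.sum_const_zero, Finset.sum_ite_eq, Finset.sum_ite_eq',
    Finset.mem_univ, if_true]
  rw [Finset.sum_comm]
  refine Finset.sum_congr rfl fun i _ => ?_
  rw [Finset.sum_comm]

theorem traceFst_posSemidef {a b : Type*} [Fintype a] {τ : Matrix (a × b) (a × b) ℂ}
    (h : τ.PosSemidef) : (traceFst τ).PosSemidef := by
  have : traceFst τ = ∑ i, τ.submatrix (fun x => (i, x)) (fun x => (i, x)) := by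
    ext x y; simp [traceFst, Matrix.sum_apply]
  rw [this]
  exact posSemidef_sum _ fun i _ => h.submatrix _

theorem trace_traceFst {a b : Type*} [Fintype a] [Fintype b] (τ : Matrix (a × b) (a × b) ℂ) :
    (traceFst τ).trace = τ.trace := by
  simp only [Matrix.trace, traceFst, diag_apply, of_apply, Fintype.sum_prod_type]
  exact Finset.sum_comm

/-- If `τ_AB ≤ c (1 ⊗ τ_B)`, then the coherent information is at most `log₂ c`. -/
theorem stateCoherentInfo_le {a b : Type*} [Fintype a] [DecidableEq a] [Fintype b] [DecidableEq b]
    {τ : Matrix (a × b) (a × b) ℂ} (hτ : IsDensity τ) {c : ℝ} (hc : 0 < c)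
    (h : ((c : ℂ) • ((1 : Matrix a a ℂ) ⊗ₖ traceFst τ) - τ).PosSemidef) :
    stateCoherentInfo τ ≤ Real.logb 2 c := by
  obtain ⟨V, hV, hV', hVd⟩ := hτ.1.1.exists_diagonalization
  have hB := traceFst_posSemidef hτ.1
  obtain ⟨U, hU, hU', hUd⟩ := hB.1.exists_diagonalization
  set l := hτ.1.1.eigenvalues
  set μ := hB.1.eigenvalues
  have hl : ∀ j, 0 ≤ l j := hτ.1.eigenvalues_nonneg
  have hμ : ∀ j, 0 ≤ μ j := hB.eigenvalues_nonneg
  have hμ1 : ∑ i, μ i = 1 := by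
    have h1 := hB.1.trace_eq_sum_eigenvalues
    rw [trace_traceFst, hτ.2] at h1
    simpa using (congrArg Complex.re h1).symm
  set W : Matrix (a × b) (a × b) ℂ := (1 : Matrix a a ℂ) ⊗ₖ U with hW
  have hWh : Wᴴ = (1 : Matrix a a ℂ) ⊗ₖ Uᴴ := by simp [hW, conjTranspose_kronecker]
  have hWW : Wᴴ * W = 1 := by rw [hWh, hW, ← mul_kronecker_mul, hU]; simp
  have hWW' : W * Wᴴ = 1 := by rw [hWh, hW, ← mul_kronecker_mul, hU']; simp
  have hσ : (c : ℂ) • ((1 : Matrix a a ℂ) ⊗ₖ traceFst τ) =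
      W * diagonal (fun p : a × b => ((c * μ p.2 : ℝ) : ℂ)) * Wᴴ := by
    have : diagonal (fun p : a × b => ((c * μ p.2 : ℝ) : ℂ)) =
        (c : ℂ) • ((1 : Matrix a a ℂ) ⊗ₖ diagonal (fun k => (μ k : ℂ))) := by
      rw [← diagonal_one, diagonal_kronecker_diagonal, ← diagonal_smul]
      congr 1
      ext p
      simp
    rw [this, hWh, hW]
    simp only [Matrix.mul_smul, Matrix.smul_mul]
    rw [← mul_kronecker_mul, ← mul_kronecker_mul, ← hUd]
    simp
  -- `G` is the change of basis between eigenvectors of `τ` and those of `1 ⊗ τ_B`. The squared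
  -- moduli in its rows are the weights in `Tr τ log (c (1 ⊗ τ_B))`.
  set G := Vᴴ * W with hGdef
  have hGG : G * Gᴴ = 1 := by
    rw [hGdef, conjTranspose_mul, conjTranspose_conjTranspose]
    calc Vᴴ * W * (Wᴴ * V) = Vᴴ * (W * Wᴴ) * V := by simp only [mul_assoc]
      _ = 1 := by rw [hWW', mul_one, hV]
  have hGrow : ∀ j, ∑ k, ‖G j k‖ ^ 2 = 1 := fun j => by
    have := congrFun (congrFun hGG j) j
    simp only [mul_apply, conjTranspose_apply, RCLike.star_def, Complex.mul_conj', one_apply_eq]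
      at this
    exact_mod_cast this
  have H : ∀ y : a × b → ℂ, ∑ j, l j * ‖(G *ᵥ y) j‖ ^ 2 ≤ ∑ k, (c * μ k.2) * ‖y k‖ ^ 2 := by
    intro y
    have h1 := h.dotProduct_mulVec_nonneg (W *ᵥ y)
    have h2 := (Complex.le_def.1 h1).1
    rw [sub_mulVec, dotProduct_sub, Complex.sub_re, star_dotProduct_mulVec_diagonalization hσ,
      star_dotProduct_mulVec_diagonalization hVd, mulVec_mulVec, mulVec_mulVec, hWW,
      one_mulVec] at h2
    simpa using h2
  have main := sum_mul_log_le_of_form_le hl (fun k => mul_nonneg hc.le (hμ k.2)) hGrow H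
  -- The diagonal of `τ` in the basis `W`, summed over the first factor, is the diagonal of `τ_B` in
  -- its own eigenbasis.
  have hcol : ∀ x, ∑ i : a, ∑ j, l j * ‖G j (i, x)‖ ^ 2 = μ x := fun x => by
    have h1 : traceFst (Wᴴ * τ * W) = diagonal (fun k => (μ k : ℂ)) := by
      rw [hWh, hW, traceFst_conj_one_kronecker]
      conv_lhs => rw [hUd]
      calc Uᴴ * (U * diagonal (fun i => (μ i : ℂ)) * Uᴴ) * U
          = (Uᴴ * U) * diagonal (fun i => (μ i : ℂ)) * (Uᴴ * U) := by simp only [mul_assoc]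
        _ = _ := by rw [hU, one_mul, mul_one]
    have h2 : Wᴴ * τ * W = Gᴴ * diagonal (fun i => (l i : ℂ)) * G := by
      conv_lhs => rw [hVd]
      rw [hGdef, conjTranspose_mul, conjTranspose_conjTranspose]
      simp only [mul_assoc]
    rw [h2] at h1
    have h3 := congrFun (congrFun h1 x) x
    simp only [traceFst, of_apply, mul_apply (M := Gᴴ * _), mul_diagonal, conjTranspose_apply,
      diagonal_apply_eq] at h3
    have h4 : ∀ i j, star (G j (i, x)) * (l j : ℂ) * G j (i, x) =
        ((l j * ‖G j (i, x)‖ ^ 2 : ℝ) : ℂ) := fun i j => by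
      rw [mul_right_comm, RCLike.star_def, Complex.conj_mul']
      push_cast; ring
    simp only [h4] at h3
    exact_mod_cast h3
  -- This is `Tr τ log (c (1 ⊗ τ_B)) = log c + Tr τ_B log τ_B`; the entropy difference then appears
  -- on comparison with `Tr τ log τ`.
  have hR : ∑ j, ∑ k : a × b, l j * ‖G j k‖ ^ 2 * Real.log (c * μ k.2) =
      Real.log c + ∑ x, μ x * Real.log (μ x) := by
    rw [Finset.sum_comm, Fintype.sum_prod_type, Finset.sum_comm]
    simp only [← Finset.sum_mul, hcol]
    have : ∀ x, μ x * Real.log (c * μ x) = Real.log c * μ x + μ x * Real.log (μ x) := fun x => by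
      rcases eq_or_ne (μ x) 0 with h0 | h0
      · simp [h0]
      · rw [Real.log_mul hc.ne' h0]; ring
    simp only [this, Finset.sum_add_distrib, ← Finset.mul_sum, hμ1, mul_one]
  rw [hR] at main
  unfold stateCoherentInfo
  rw [vonNeumannEntropy_eq_sum hU hUd, vonNeumannEntropy_eq_sum hV hVd, ← sub_div, Real.logb]
  refine div_le_div_of_nonneg_right ?_ (Real.log_pos one_lt_two).le
  simp only [Real.negMulLog, neg_mul, Finset.sum_neg_distrib]
  linarith

/-! ### Kraus sums with a property of the operators, Choi's theorem, tensor powers -/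

/-- `Φ` is a finite sum of maps `ρ ↦ K ρ Kᴴ` with operators `K` satisfying `P`. -/
def IsKrausSum {a b : Type*} [Fintype a] (P : Matrix b a ℂ → Prop) (Φ : OpMap a b) : Prop :=
  ∃ (ι : Type) (_ : Fintype ι) (K : ι → Matrix b a ℂ), (∀ i, P (K i)) ∧ Φ = ∑ i, conjMap (K i)

/-- Matrices of rank at most one. -/
def IsRankOne {a b : Type*} (K : Matrix b a ℂ) : Prop := ∃ u v, K = vecMulVec u v

theorem conjMap_apply {a b : Type*} [Fintype a] (K : Matrix b a ℂ) (ρ : Matrix a a ℂ) :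
    conjMap K ρ = K * ρ * Kᴴ := rfl

theorem conjMap_comp {a b c : Type*} [Fintype a] [Fintype b] (L : Matrix c b ℂ)
    (K : Matrix b a ℂ) : conjMap L ∘ₗ conjMap K = conjMap (L * K) := by
  refine LinearMap.ext fun ρ => ?_
  simp only [LinearMap.comp_apply, conjMap_apply, conjTranspose_mul, Matrix.mul_assoc]

theorem smul_conjMap {a b : Type*} [Fintype a] {t : ℝ} (ht : 0 ≤ t) (K : Matrix b a ℂ) :
    (t : ℂ) • conjMap K = conjMap (((√t : ℝ) : ℂ) • K) := by
  refine LinearMap.ext fun ρ => ?_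
  rw [LinearMap.smul_apply, conjMap_apply, conjMap_apply, conjTranspose_smul, Matrix.smul_mul,
    Matrix.smul_mul, Matrix.mul_smul, smul_smul, RCLike.star_def, Complex.conj_ofReal,
    ← Complex.ofReal_mul, Real.mul_self_sqrt ht]

theorem conjMap_id {a : Type*} [Fintype a] [DecidableEq a] :
    conjMap (1 : Matrix a a ℂ) = LinearMap.id :=
  LinearMap.ext fun ρ => by simp [conjMap_apply]

namespace IsKrausSum

variable {a b c : Type*} [Fintype a]

theorem of_conjMap {P : Matrix b a ℂ → Prop} {K : Matrix b a ℂ} (h : P K) :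
    IsKrausSum P (conjMap K) :=
  ⟨Unit, inferInstance, fun _ => K, fun _ => h, by simp⟩

theorem add {P : Matrix b a ℂ → Prop} {Φ Ψ : OpMap a b} (h : IsKrausSum P Φ)
    (h' : IsKrausSum P Ψ) : IsKrausSum P (Φ + Ψ) := by
  obtain ⟨ι, _, K, hK, rfl⟩ := h
  obtain ⟨κ, _, L, hL, rfl⟩ := h'
  refine ⟨ι ⊕ κ, inferInstance, Sum.elim K L, ?_, by simp⟩
  rintro (i | j)
  exacts [hK i, hL j]

theorem smul {P : Matrix b a ℂ → Prop} (hP : ∀ (z : ℂ) K, P K → P (z • K)) {Φ : OpMap a b}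
    (h : IsKrausSum P Φ) {t : ℂ} (ht : 0 ≤ t) : IsKrausSum P (t • Φ) := by
  obtain ⟨h1, h2⟩ := Complex.nonneg_iff.1 ht
  have ht' : t = ((t.re : ℝ) : ℂ) := Complex.ext rfl (by simp [← h2])
  obtain ⟨ι, _, K, hK, rfl⟩ := h
  refine ⟨ι, inferInstance, fun i => ((√t.re : ℝ) : ℂ) • K i, fun i => hP _ _ (hK i), ?_⟩
  rw [ht']
  simp only [Finset.smul_sum, smul_conjMap h1, Complex.ofReal_re]

theorem comp [Fintype b] {P : Matrix c b ℂ → Prop} {Q : Matrix b a ℂ → Prop} {R : Matrix c a ℂ → Prop}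
    (hR : ∀ L K, P L → Q K → R (L * K)) {Ψ : OpMap b c} {Φ : OpMap a b} (h : IsKrausSum P Ψ)
    (h' : IsKrausSum Q Φ) : IsKrausSum R (Ψ ∘ₗ Φ) := by
  obtain ⟨ι, _, L, hL, rfl⟩ := h
  obtain ⟨κ, _, K, hK, rfl⟩ := h'
  refine ⟨ι × κ, inferInstance, fun p => L p.1 * K p.2, fun p => hR _ _ (hL _) (hK _), ?_⟩
  refine LinearMap.ext fun ρ => ?_
  simp only [Fintype.sum_prod_type, LinearMap.comp_apply, LinearMap.sum_apply, map_sum,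
    ← conjMap_comp]
  exact Finset.sum_comm

end IsKrausSum

theorem ampliation_apply {k a b : Type*} (Φ : OpMap a b) (ρ : Matrix (k × a) (k × a) ℂ) (p q) :
    ampliation k Φ ρ p q = Φ (Matrix.of fun x y => ρ (p.1, x) (q.1, y)) p.2 q.2 := rfl

theorem ampliation_sum {k a b ι : Type*} [Fintype ι] (Φ : ι → OpMap a b) :
    ampliation k (∑ i, Φ i) = ∑ i, ampliation k (Φ i) := by
  refine LinearMap.ext fun ρ => ?_
  ext p q
  simp [ampliation_apply, LinearMap.sum_apply, Matrix.sum_apply]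

theorem ampliation_conjMap {k a b : Type*} [Fintype k] [DecidableEq k] [Fintype a]
    (K : Matrix b a ℂ) : ampliation k (conjMap K) = conjMap ((1 : Matrix k k ℂ) ⊗ₖ K) := by
  refine LinearMap.ext fun ρ => ?_
  ext p q
  simp [ampliation_apply, conjMap_apply, mul_apply, Fintype.sum_prod_type, one_apply,
    Finset.sum_ite_irrel, apply_ite (starRingEnd ℂ)]

theorem IsKrausSum.ampliation_posSemidef {k a b : Type*} [Fintype k] [Fintype a] [Fintype b]
    {P : Matrix b a ℂ → Prop} {Φ : OpMap a b} (h : IsKrausSum P Φ)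
    {ρ : Matrix (k × a) (k × a) ℂ} (hρ : ρ.PosSemidef) : (ampliation k Φ ρ).PosSemidef := by
  classical
  obtain ⟨ι, _, K, -, rfl⟩ := h
  rw [ampliation_sum, LinearMap.sum_apply]
  refine posSemidef_sum _ fun i _ => ?_
  rw [ampliation_conjMap]
  exact hρ.mul_mul_conjTranspose_same _

theorem IsKrausSum.isChannel {a b : Type*} [Fintype a] [Fintype b]
    {P : Matrix b a ℂ → Prop} {Φ : OpMap a b} (h : IsKrausSum P Φ)
    (ht : ∀ ρ, (Φ ρ).trace = ρ.trace) : IsChannel Φ :=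
  ⟨fun _ _ => h.ampliation_posSemidef, ht⟩

theorem OpMap.apply_eq_sum {a b : Type*} [Fintype a] [DecidableEq a] (Φ : OpMap a b)
    (ρ : Matrix a a ℂ) (x y : b) :
    Φ ρ x y = ∑ i, ∑ j, ρ i j * Φ (Matrix.single i j 1) x y := by
  conv_lhs => rw [matrix_eq_sum_single ρ]
  simp only [map_sum, Matrix.sum_apply]
  refine Finset.sum_congr rfl fun i _ => Finset.sum_congr rfl fun j _ => ?_
  have : Matrix.single i j (ρ i j) = ρ i j • Matrix.single i j (1 : ℂ) := by simp
  rw [this, map_smul, Matrix.smul_apply, smul_eq_mul]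

theorem conjMap_single {a b : Type*} [Fintype a] [DecidableEq a] (K : Matrix b a ℂ) (i j : a)
    (x y : b) : conjMap K (Matrix.single i j 1) x y = K x i * star (K y j) := by
  simp [conjMap_apply, mul_apply, single_apply, ite_and]

/-- Choi's theorem: the image of an unnormalised maximally entangled projector is positive
semidefinite, hence a sum of `|w⟩⟨w|`, and each `w` reshaped into a matrix is a Kraus operator. -/
theorem IsChannel.isKrausSum {a b : Type*} [Fintype a] [Fintype b] {Φ : OpMap a b}
    (h : IsChannel Φ) : IsKrausSum (fun _ => True) Φ := by
  classical
  -- Complete positivity is tested only against reference systems `Fin k`, so the reference copy of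
  -- `a` is enumerated.
  let e := Fintype.equivFin a
  let v : Fin (Fintype.card a) × a → ℂ := fun p => if e p.2 = p.1 then 1 else 0
  have hC := h.completelyPositive _ _ (posSemidef_vecMulVec_self_star v)
  obtain ⟨m, w, hw⟩ := posSemidef_iff_eq_sum_vecMulVec.1 hC
  refine ⟨Fin m, inferInstance, fun l => Matrix.of fun x i => w l (e i, x), fun _ => trivial, ?_⟩
  have key : ∀ i j x y, Φ (Matrix.single i j 1) x y = ∑ l, w l (e i, x) * star (w l (e j, y)) := by
    intro i j x y
    have h1 := congrFun (congrFun hw (e i, x)) (e j, y)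
    rw [ampliation_apply] at h1
    have h2 : (Matrix.of fun x y => vecMulVec v (star v) (e i, x) (e j, y)) =
        Matrix.single i j 1 := by
      ext x y
      rcases eq_or_ne x i with rfl | hi
      · rcases eq_or_ne y j with rfl | hj
        · simp [vecMulVec_apply, v]
        · simp [vecMulVec_apply, v, hj, hj.symm]
      · simp [vecMulVec_apply, v, hi, hi.symm]
    rw [h2] at h1
    simpa [Matrix.sum_apply, vecMulVec_apply] using h1
  refine LinearMap.ext fun ρ => ?_
  ext x y
  rw [OpMap.apply_eq_sum, OpMap.apply_eq_sum]
  simp only [LinearMap.sum_apply, Matrix.sum_apply, conjMap_single, of_apply, key]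

theorem tensorPower_apply {a b : Type*} [Fintype a] [DecidableEq a] (Φ : OpMap a b) (n : ℕ)
    (ρ : Matrix (Fin n → a) (Fin n → a) ℂ) (x y : Fin n → b) :
    tensorPower Φ n ρ x y =
      ∑ i, ∑ j, ρ i j * ∏ k, Φ (Matrix.single (i k) (j k) 1) (x k) (y k) := rfl

/-- Expanding the product of sums gives one Kraus operator for each choice of a Kraus operator in
every factor. The property `Q` is what the product operators inherit from `P`. -/
theorem IsKrausSum.tensorPower {a b : Type*} [Fintype a] [DecidableEq a] [Fintype b]
    {P : Matrix b a ℂ → Prop} {n : ℕ} {Q : Matrix (Fin n → b) (Fin n → a) ℂ → Prop}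
    (hQ : ∀ K : Fin n → Matrix b a ℂ, (∀ k, P (K k)) →
      Q (Matrix.of fun x i => ∏ k, K k (x k) (i k)))
    {Φ : OpMap a b} (h : IsKrausSum P Φ) : IsKrausSum Q (tensorPower Φ n) := by
  obtain ⟨ι, _, K, hK, rfl⟩ := h
  classical
  refine ⟨Fin n → ι, inferInstance, fun l => Matrix.of fun x i => ∏ k, K (l k) (x k) (i k),
    fun l => hQ _ fun k => hK _, LinearMap.ext fun ρ => ?_⟩
  ext x y
  rw [tensorPower_apply, OpMap.apply_eq_sum]
  refine Finset.sum_congr rfl fun i _ => Finset.sum_congr rfl fun j _ => ?_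
  simp only [LinearMap.sum_apply, Matrix.sum_apply, conjMap_single, of_apply]
  rw [Finset.prod_univ_sum, Fintype.piFinset_univ]
  simp only [Finset.prod_mul_distrib, star_prod]

/-- The sum over output strings factorises, and trace preservation on matrix units turns each factor
into a Kronecker delta. -/
theorem trace_tensorPower {a b : Type*} [Fintype a] [DecidableEq a] [Fintype b] {Φ : OpMap a b}
    (h : ∀ ρ, (Φ ρ).trace = ρ.trace) (n : ℕ) (ρ : Matrix (Fin n → a) (Fin n → a) ℂ) :
    (tensorPower Φ n ρ).trace = ρ.trace := by
  simp only [Matrix.trace, diag_apply, tensorPower_apply]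
  rw [Finset.sum_comm]
  refine Finset.sum_congr rfl fun i _ => ?_
  rw [Finset.sum_comm]
  have key : ∀ j, ∑ x : Fin n → b, ∏ k, Φ (Matrix.single (i k) (j k) 1) (x k) (x k) =
      if i = j then 1 else 0 := by
    intro j
    have h1 := Finset.prod_univ_sum (fun _ : Fin n => (Finset.univ : Finset b))
      (fun k x => Φ (Matrix.single (i k) (j k) 1) x x)
    rw [Fintype.piFinset_univ] at h1
    rw [← h1]
    have h2 : ∀ k, ∑ x, Φ (Matrix.single (i k) (j k) 1) x x = if i k = j k then 1 else 0 := by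
      intro k
      have := h (Matrix.single (i k) (j k) 1)
      rw [Matrix.trace] at this
      simp only [diag_apply] at this
      rw [this]
      split_ifs with hk
      · rw [hk, trace_single_eq_same]
      · rw [trace_single_eq_of_ne _ _ _ hk]
    simp only [h2, Finset.prod_ite_zero, Finset.prod_const_one, Finset.mem_univ, true_implies,
      funext_iff]
  simp only [← Finset.mul_sum, key]
  simp

theorem IsChannel.tensorPower {a b : Type*} [Fintype a] [DecidableEq a] [Fintype b]
    {Φ : OpMap a b} (h : IsChannel Φ) (n : ℕ) : IsChannel (tensorPower Φ n) :=
  (h.isKrausSum.tensorPower (Q := fun _ => True) fun _ _ => trivial).isChannel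
    (trace_tensorPower h.tracePreserving n)

theorem IsChannel.comp {a b c : Type*} [Fintype a] [Fintype b] [Fintype c]
    {Ψ : OpMap b c} {Φ : OpMap a b} (h : IsChannel Ψ) (h' : IsChannel Φ) : IsChannel (Ψ ∘ₗ Φ) :=
  (h.isKrausSum.comp (R := fun _ => True) (fun _ _ _ _ => trivial) h'.isKrausSum).isChannel
    fun ρ => by rw [LinearMap.comp_apply, h.tracePreserving, h'.tracePreserving]

theorem IsRankOne.tensorPower {a b : Type*} {n : ℕ} (K : Fin n → Matrix b a ℂ)
    (h : ∀ k, IsRankOne (K k)) :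
    IsRankOne (Matrix.of fun (x : Fin n → b) (i : Fin n → a) => ∏ k, K k (x k) (i k)) := by
  choose u v huv using h
  refine ⟨fun x => ∏ k, u k (x k), fun i => ∏ k, v k (i k), ?_⟩
  ext x i
  simp [huv, vecMulVec_apply, Finset.prod_mul_distrib]

theorem IsRankOne.mul_left {a b c : Type*} [Fintype b] {K : Matrix b a ℂ} (h : IsRankOne K)
    (L : Matrix c b ℂ) : IsRankOne (L * K) := by
  obtain ⟨u, v, rfl⟩ := h
  exact ⟨L *ᵥ u, v, mul_vecMulVec _ _ _⟩

theorem IsRankOne.mul_right {a b c : Type*} [Fintype b] {K : Matrix c b ℂ} (h : IsRankOne K)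
    (L : Matrix b a ℂ) : IsRankOne (K * L) := by
  obtain ⟨u, v, rfl⟩ := h
  exact ⟨u, v ᵥ* L, vecMulVec_mul _ _ _⟩

theorem IsChannel.isDensity_ampliation {k a b : Type*} [Fintype k] [Fintype a] [Fintype b]
    {Φ : OpMap a b} (h : IsChannel Φ) {ρ : Matrix (k × a) (k × a) ℂ} (hρ : IsDensity ρ) :
    IsDensity (ampliation k Φ ρ) := by
  refine ⟨h.isKrausSum.ampliation_posSemidef hρ.1, ?_⟩
  rw [← hρ.2]
  simp only [Matrix.trace, diag_apply, Fintype.sum_prod_type, ampliation_apply]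
  exact Finset.sum_congr rfl fun i _ => h.tracePreserving _

/-! ### Reduction and pinching inequalities, and the resulting capacity bounds -/

theorem Matrix.PosSemidef.trace_smul_one_sub {a : Type*} [Fintype a] [DecidableEq a]
    {σ : Matrix a a ℂ} (h : σ.PosSemidef) : (σ.trace • (1 : Matrix a a ℂ) - σ).PosSemidef := by
  obtain ⟨U, hU, hU', hd⟩ := h.1.exists_diagonalization
  have ht := h.1.trace_eq_sum_eigenvalues
  have hl := h.eigenvalues_nonneg
  set l := h.1.eigenvalues
  have : σ.trace • (1 : Matrix a a ℂ) - σ =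
      U * diagonal (fun i => ((∑ j, l j - l i : ℝ) : ℂ)) * Uᴴ := by
    have h1 : diagonal (fun i => ((∑ j, l j - l i : ℝ) : ℂ)) =
        σ.trace • (1 : Matrix a a ℂ) - diagonal (fun i => (l i : ℂ)) := by
      rw [ht, ← diagonal_one, ← diagonal_smul, diagonal_sub]
      congr 1; ext i; simp
    rw [h1, Matrix.mul_sub, Matrix.sub_mul, ← hd, Matrix.mul_smul, Matrix.smul_mul, mul_one, hU']
  rw [this]
  refine PosSemidef.mul_mul_conjTranspose_same (posSemidef_diagonal_iff.2 fun i => ?_) _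
  rw [Complex.zero_le_real, sub_nonneg]
  exact Finset.single_le_sum (fun j _ => hl j) (Finset.mem_univ i)

theorem traceFst_sum {a b ι : Type*} [Fintype a] [Fintype ι]
    (σ : ι → Matrix (a × b) (a × b) ℂ) : traceFst (∑ i, σ i) = ∑ i, traceFst (σ i) := by
  ext x y
  simp only [traceFst, of_apply, Matrix.sum_apply]
  exact Finset.sum_comm

theorem traceFst_kronecker {a b : Type*} [Fintype a] (α : Matrix a a ℂ) (β : Matrix b b ℂ) :
    traceFst (α ⊗ₖ β) = α.trace • β := by
  ext x y
  simp [traceFst, Matrix.trace, Finset.sum_mul]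

/-- The reduction criterion for the outputs of maps with Kraus operators of rank one. -/
theorem IsKrausSum.one_kronecker_traceFst_sub {k a b : Type*} [Fintype k] [DecidableEq k]
    [Fintype a] [Fintype b] {Φ : OpMap a b} (h : IsKrausSum IsRankOne Φ)
    {ρ : Matrix (k × a) (k × a) ℂ} (hρ : ρ.PosSemidef) :
    ((1 : Matrix k k ℂ) ⊗ₖ traceFst (ampliation k Φ ρ) - ampliation k Φ ρ).PosSemidef := by
  obtain ⟨ι, _, K, hK, rfl⟩ := h
  choose u v huv using hK
  -- For `K l = u vᵀ`, the operator `V l` contracts the input with `v`. Each Kraus term of the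
  -- output is thus a product `σ ⊗ |u⟩⟨u|`, and for these the claim is `σ ≤ Tr σ`.
  let V : ι → Matrix k (k × a) ℂ := fun l => Matrix.of fun i p => if i = p.1 then v l p.2 else 0
  have hσ : ∀ l, (V l * ρ * (V l)ᴴ).PosSemidef := fun l => hρ.mul_mul_conjTranspose_same _
  have key : ∀ l, ampliation k (conjMap (K l)) ρ =
      (V l * ρ * (V l)ᴴ) ⊗ₖ vecMulVec (u l) (star (u l)) := by
    intro l
    rw [ampliation_conjMap, conjMap_apply]
    have h1 : (1 : Matrix k k ℂ) ⊗ₖ K l = (1 : Matrix k k ℂ) ⊗ₖ replicateCol Unit (u l) *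
        (V l).submatrix (fun p : k × Unit => p.1) id := by
      ext ⟨i, x⟩ ⟨j, y⟩
      simp [huv l, mul_apply, Fintype.sum_prod_type, one_apply, V, vecMulVec_apply]
    rw [h1, conjTranspose_mul]
    ext ⟨i, x⟩ ⟨j, y⟩
    have h2 : ∀ M : Matrix (k × Unit) (k × Unit) ℂ,
        ((1 : Matrix k k ℂ) ⊗ₖ replicateCol Unit (u l) * M *
          ((1 : Matrix k k ℂ) ⊗ₖ replicateCol Unit (u l))ᴴ) (i, x) (j, y) =
        M (i, ()) (j, ()) * (u l x * star (u l y)) := by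
      intro M
      simp [mul_apply, Fintype.sum_prod_type, one_apply, apply_ite (starRingEnd ℂ)]
      ring
    simp only [← Matrix.mul_assoc] at h2 ⊢
    rw [Matrix.mul_assoc _ _ ρ, Matrix.mul_assoc _ _ (submatrix _ _ _)ᴴ, h2]
    rfl
  rw [ampliation_sum, LinearMap.sum_apply, traceFst_sum]
  have h3 : (1 : Matrix k k ℂ) ⊗ₖ (∑ l, traceFst (ampliation k (conjMap (K l)) ρ)) =
      ∑ l, (1 : Matrix k k ℂ) ⊗ₖ traceFst (ampliation k (conjMap (K l)) ρ) := by
    ext p q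
    simp [Matrix.sum_apply, Finset.mul_sum]
  rw [h3, ← Finset.sum_sub_distrib]
  refine posSemidef_sum _ fun l _ => ?_
  rw [key, traceFst_kronecker, kronecker_smul, ← smul_kronecker]
  have h4 : ((V l * ρ * (V l)ᴴ).trace • (1 : Matrix k k ℂ)) ⊗ₖ vecMulVec (u l) (star (u l)) -
      (V l * ρ * (V l)ᴴ) ⊗ₖ vecMulVec (u l) (star (u l)) =
      ((V l * ρ * (V l)ᴴ).trace • (1 : Matrix k k ℂ) - V l * ρ * (V l)ᴴ) ⊗ₖ
        vecMulVec (u l) (star (u l)) := by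
    ext p q
    simp only [Matrix.sub_apply, kroneckerMap_apply, sub_mul]
  rw [h4]
  exact (hσ l).trace_smul_one_sub.kronecker (posSemidef_vecMulVec_self_star _)

/-- Pinching: with `P i = |i⟩⟨i| ⊗ 1`, the sum of `(P i - P j) τ (P i - P j)` over all pairs is
twice `d ∑ P i τ P i - τ`, where `d` is the dimension of the first factor. The pinched state is
below `1 ⊗ τ_B`, since the difference collects the diagonal blocks of `τ` tensored with `1 -
|j⟩⟨j|`. -/
theorem card_smul_one_kronecker_traceFst_sub {k b : Type*} [Fintype k] [DecidableEq k] [Fintype b]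
    {τ : Matrix (k × b) (k × b) ℂ} (h : τ.PosSemidef) :
    (((Fintype.card k : ℝ) : ℂ) • ((1 : Matrix k k ℂ) ⊗ₖ traceFst τ) - τ).PosSemidef := by
  classical
  let D : k → k → Matrix (k × b) (k × b) ℂ := fun i j => diagonal fun p =>
    (if p.1 = i then 1 else 0) - (if p.1 = j then 1 else 0)
  have key : ((Fintype.card k : ℝ) : ℂ) • ((1 : Matrix k k ℂ) ⊗ₖ traceFst τ) - τ =
      (Fintype.card k : ℝ) • ∑ j, (1 - Matrix.single j j (1 : ℂ)) ⊗ₖ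
        τ.submatrix (fun x => (j, x)) (fun x => (j, x)) +
      (1 / 2 : ℝ) • ∑ i, ∑ j, D i j * τ * (D i j)ᴴ := by
    ext ⟨p, x⟩ ⟨q, y⟩
    have h1 : ∀ i j, (D i j * τ * (D i j)ᴴ) (p, x) (q, y) =
        (((if p = i then 1 else 0) * (if q = i then 1 else 0) -
          (if p = i then 1 else 0) * (if q = j then 1 else 0)) -
        ((if p = j then 1 else 0) * (if q = i then 1 else 0) -
          (if p = j then 1 else 0) * (if q = j then 1 else 0))) * τ (p, x) (q, y) := by
      intro i j
      simp only [D, diagonal_conjTranspose, mul_diagonal, diagonal_mul, Pi.star_apply, star_sub,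
        apply_ite (star : ℂ → ℂ), star_one, star_zero]
      ring
    have h2 : (∑ i, ∑ j, D i j * τ * (D i j)ᴴ) (p, x) (q, y) =
        2 * ((Fintype.card k : ℂ) * (if p = q then 1 else 0) - 1) * τ (p, x) (q, y) := by
      simp only [Matrix.sum_apply, h1, ← Finset.sum_mul, Finset.sum_sub_distrib]
      rcases eq_or_ne p q with rfl | hpq
      · simp only [if_true, mul_one, Finset.sum_const, Finset.sum_ite_eq, Finset.mem_univ,
          Finset.card_univ, nsmul_eq_mul, mul_ite, mul_zero]
        ring
      · simp [hpq]; ring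
    have h3 : (∑ j, (1 - Matrix.single j j (1 : ℂ)) ⊗ₖ
        τ.submatrix (fun x => (j, x)) (fun x => (j, x))) (p, x) (q, y) =
        (if p = q then 1 else 0) * (∑ j, τ (j, x) (j, y) - τ (p, x) (q, y)) := by
      simp only [Matrix.sum_apply, kroneckerMap_apply, Matrix.sub_apply, sub_mul,
        Finset.sum_sub_distrib, submatrix_apply, ← Finset.mul_sum, one_apply, mul_sub]
      congr 1
      rcases eq_or_ne p q with rfl | hpq
      · simp [single_apply]
      · rw [if_neg hpq, zero_mul]
        refine Finset.sum_eq_zero fun j _ => ?_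
        rw [single_apply, if_neg, zero_mul]
        rintro ⟨rfl, rfl⟩
        exact hpq rfl
    rw [Matrix.add_apply, Matrix.smul_apply, Matrix.smul_apply, h2, h3, Matrix.sub_apply,
      Matrix.smul_apply, kroneckerMap_apply, one_apply, traceFst, of_apply]
    simp only [Complex.real_smul, smul_eq_mul]
    push_cast
    ring
  rw [key]
  refine PosSemidef.add (PosSemidef.smul (posSemidef_sum _ fun j _ => ?_) (by positivity))
    (PosSemidef.smul (posSemidef_sum _ fun i _ => posSemidef_sum _ fun j _ =>
      h.mul_mul_conjTranspose_same _) (by norm_num))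
  refine PosSemidef.kronecker ?_ (h.submatrix _)
  rw [← diagonal_one, ← diagonal_single, diagonal_sub]
  refine PosSemidef.diagonal fun i => ?_
  rcases eq_or_ne i j with rfl | hij
  · simp
  · simp [hij]

theorem IsChannel.stateCoherentInfo_le_logb_card {a b : Type*} [Fintype a] [DecidableEq a]
    [Fintype b] [DecidableEq b] {Φ : OpMap a b} (hΦ : IsChannel Φ)
    {ρ : Matrix (a × a) (a × a) ℂ} (hρ : IsDensity ρ) :
    stateCoherentInfo (ampliation a Φ ρ) ≤ Real.logb 2 (Fintype.card a) := by
  have hτ := hΦ.isDensity_ampliation hρ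
  have : Nonempty a := by
    by_contra hne
    rw [not_nonempty_iff] at hne
    have := hρ.2
    rw [Matrix.trace_eq_zero_of_isEmpty] at this
    exact zero_ne_one this
  exact stateCoherentInfo_le hτ (by exact_mod_cast Fintype.card_pos)
    (card_smul_one_kronecker_traceFst_sub hτ.1)

/-- The reduction criterion is the case `c = 1` of `stateCoherentInfo_le`. A product input with a
pure reference attains the value zero. -/
theorem hasCoherentInfo_zero_of_isRankOne {a b : Type*} [Fintype a] [DecidableEq a] [Nonempty a]
    [Fintype b] [DecidableEq b] {Φ : OpMap a b} (hΦ : IsChannel Φ)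
    (h : IsKrausSum IsRankOne Φ) : HasCoherentInfo Φ 0 := by
  constructor
  · obtain ⟨i⟩ := ‹Nonempty a›
    have hs : (Matrix.single i i (1 : ℂ)).PosSemidef := by
      rw [← diagonal_single]
      refine PosSemidef.diagonal ?_
      rw [Pi.single_nonneg]
      exact zero_le_one
    have hρ : IsDensity (Matrix.single i i (1 : ℂ) ⊗ₖ Matrix.single i i (1 : ℂ)) :=
      ⟨hs.kronecker hs, by rw [trace_kronecker]; simp⟩
    refine ⟨_, hρ, ?_⟩
    have h1 : ampliation a Φ (Matrix.single i i (1 : ℂ) ⊗ₖ Matrix.single i i (1 : ℂ)) =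
        Matrix.single i i (1 : ℂ) ⊗ₖ Φ (Matrix.single i i (1 : ℂ)) := by
      ext p q
      rw [ampliation_apply, kroneckerMap_apply]
      have : (Matrix.of fun x y => (Matrix.single i i (1 : ℂ) ⊗ₖ Matrix.single i i (1 : ℂ))
          (p.1, x) (q.1, y)) = Matrix.single i i (1 : ℂ) p.1 q.1 • Matrix.single i i (1 : ℂ) := rfl
      rw [this, map_smul, Matrix.smul_apply, smul_eq_mul]
    have hd := traceFst_posSemidef (hΦ.isDensity_ampliation hρ).1
    have h2 : traceFst (Matrix.single i i (1 : ℂ) ⊗ₖ Φ (Matrix.single i i (1 : ℂ))) =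
        Φ (Matrix.single i i (1 : ℂ)) := by
      rw [traceFst_kronecker, trace_single_eq_same, one_smul]
    rw [h1, h2] at hd
    rw [stateCoherentInfo, h1, h2, vonNeumannEntropy_single_kronecker i hd.1, sub_self]
  · rintro x ⟨ρ, hρ, rfl⟩
    have := stateCoherentInfo_le (hΦ.isDensity_ampliation hρ) one_pos (by
      simpa using h.one_kronecker_traceFst_sub hρ.1)
    simpa using this

theorem hasQuantumCapacity_zero_of_isRankOne {a b : Type*} [Fintype a] [DecidableEq a] [Nonempty a]
    [Fintype b] [DecidableEq b] {Φ : OpMap a b} (hΦ : IsChannel Φ)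
    (h : IsKrausSum IsRankOne Φ) : HasQuantumCapacity Φ 0 :=
  ⟨fun _ => 0, fun n => hasCoherentInfo_zero_of_isRankOne (hΦ.tensorPower n)
    (h.tensorPower IsRankOne.tensorPower), by simp⟩

theorem HasQuantumCapacity.le_logb_card {a b : Type*} [Fintype a] [DecidableEq a] [Fintype b]
    [DecidableEq b] {Φ : OpMap a b} (hΦ : IsChannel Φ) {Q : ℝ} (h : HasQuantumCapacity Φ Q) :
    Q ≤ Real.logb 2 (Fintype.card a) := by
  obtain ⟨c, hc, hQ⟩ := h
  -- Restricting to `n ≥ 1` excludes the quotient `c 0 / 0`.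
  refine le_of_tendsto hQ (Filter.eventually_atTop.2 ⟨1, fun n hn => ?_⟩)
  obtain ⟨ρ, hρ, hcn⟩ := (hc n).1
  have h1 := (hΦ.tensorPower n).stateCoherentInfo_le_logb_card hρ
  rw [← hcn] at h1
  rw [div_le_iff₀ (by exact_mod_cast hn)]
  simpa [Real.logb_pow, mul_comm] using h1

/-! ### The SWITCH as a Kraus sum and its control blocks -/

theorem IsKrausSum.zero {a b : Type*} [Fintype a] {P : Matrix b a ℂ → Prop} :
    IsKrausSum P (0 : OpMap a b) :=
  ⟨Empty, inferInstance, Empty.elim, fun i => i.elim, by simp⟩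

theorem IsKrausSum.sum {a b ι : Type*} [Fintype a] {P : Matrix b a ℂ → Prop} (s : Finset ι)
    {Φ : ι → OpMap a b} (h : ∀ i ∈ s, IsKrausSum P (Φ i)) : IsKrausSum P (∑ i ∈ s, Φ i) :=
  Finset.sum_induction _ _ (fun _ _ => IsKrausSum.add) IsKrausSum.zero h

/-- The map `ρ ↦ ρ ⊗ ω`. -/
noncomputable def appendMap {a c : Type*} (ω : Matrix c c ℂ) : OpMap a (a × c) where
  toFun ρ := ρ ⊗ₖ ω
  map_add' ρ σ := add_kronecker ρ σ ω
  map_smul' t ρ := smul_kronecker t ρ ω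

theorem isKrausSum_appendMap {a c : Type*} [Fintype a] [Finite c] {ω : Matrix c c ℂ}
    (h : ω.PosSemidef) : IsKrausSum (fun _ => True) (appendMap ω : OpMap a (a × c)) := by
  classical
  obtain ⟨m, w, rfl⟩ := posSemidef_iff_eq_sum_vecMulVec.1 h
  refine ⟨Fin m, inferInstance, fun l => Matrix.of fun p i => if p.1 = i then w l p.2 else 0,
    fun _ => trivial, LinearMap.ext fun ρ => ?_⟩
  ext p q
  simp [appendMap, conjMap_apply, mul_apply, Matrix.sum_apply, vecMulVec_apply, Finset.mul_sum,
    apply_ite (starRingEnd ℂ)]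
  exact Finset.sum_congr rfl fun _ _ => by ring

theorem isKrausSum_switchMap {d : Type*} [Fintype d] {r s : ℕ} (E : Fin r → Matrix d d ℂ)
    (F : Fin s → Matrix d d ℂ) {ω : Matrix (Fin 2) (Fin 2) ℂ} (h : ω.PosSemidef) :
    IsKrausSum (fun _ => True) (switchMap E F ω) := by
  have : switchMap E F ω = ∑ i, ∑ j, conjMap (switchKraus E F i j) ∘ₗ appendMap ω := by
    refine LinearMap.ext fun ρ => ?_
    simp only [LinearMap.sum_apply]
    rfl
  rw [this]
  exact IsKrausSum.sum _ fun i _ => IsKrausSum.sum _ fun j _ =>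
    (IsKrausSum.of_conjMap (P := fun _ => True) trivial).comp (fun _ _ _ _ => trivial)
      (isKrausSum_appendMap h)

/-- The four blocks of the output of the SWITCH with respect to the control. -/
theorem switchMap_apply_eq {d : Type*} [Fintype d] [DecidableEq d] {r s : ℕ} {Φ Ψ : OpMap d d}
    {E : Fin r → Matrix d d ℂ} {F : Fin s → Matrix d d ℂ} (hE : IsKrausRep E Φ)
    (hF : IsKrausRep F Ψ) (ω : Matrix (Fin 2) (Fin 2) ℂ) (ρ : Matrix d d ℂ) :
    switchMap E F ω ρ =
      Φ (Ψ ρ) ⊗ₖ (Matrix.single 0 0 1 * ω * Matrix.single 0 0 1) +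
      (∑ j, Φ (F j * ρ) * (F j)ᴴ) ⊗ₖ (Matrix.single 0 0 1 * ω * Matrix.single 1 1 1) +
      (∑ j, F j * Φ (ρ * (F j)ᴴ)) ⊗ₖ (Matrix.single 1 1 1 * ω * Matrix.single 0 0 1) +
      Ψ (Φ ρ) ⊗ₖ (Matrix.single 1 1 1 * ω * Matrix.single 1 1 1) := by
  have h : ∀ i j, switchKraus E F i j * (ρ ⊗ₖ ω) * (switchKraus E F i j)ᴴ =
      (E i * (F j * ρ * (F j)ᴴ) * (E i)ᴴ) ⊗ₖ
        (Matrix.single 0 0 1 * ω * Matrix.single 0 0 1) +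
      (E i * (F j * ρ) * (E i)ᴴ * (F j)ᴴ) ⊗ₖ (Matrix.single 0 0 1 * ω * Matrix.single 1 1 1) +
      (F j * (E i * (ρ * (F j)ᴴ) * (E i)ᴴ)) ⊗ₖ
        (Matrix.single 1 1 1 * ω * Matrix.single 0 0 1) +
      (F j * (E i * ρ * (E i)ᴴ) * (F j)ᴴ) ⊗ₖ
        (Matrix.single 1 1 1 * ω * Matrix.single 1 1 1) := by
    intro i j
    have h0 : ∀ k : Fin 2, (Matrix.single k k (1 : ℂ))ᴴ = Matrix.single k k 1 := by simp
    simp only [switchKraus, conjTranspose_add, conjTranspose_kronecker, conjTranspose_mul, h0,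
      Matrix.add_mul, Matrix.mul_add, ← mul_kronecker_mul, Matrix.mul_assoc]
    abel
  have e : switchMap E F ω ρ =
    ∑ i, ∑ j, switchKraus E F i j * (ρ ⊗ₖ ω) * (switchKraus E F i j)ᴴ := rfl
  have hsum : ∀ {n : ℕ} (f : Fin n → Matrix d d ℂ) (g : Matrix (Fin 2) (Fin 2) ℂ),
      ∑ i, f i ⊗ₖ g = (∑ i, f i) ⊗ₖ g := by
    intro n f g
    ext p q
    simp [Matrix.sum_apply, Finset.sum_mul]
  -- In every block the sum over `i` reassembles `Φ`. In the two diagonal blocks the sum over `j`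
  -- reassembles `Ψ` as well; in the others the operators `F j` remain.
  simp only [e, h, Finset.sum_add_distrib, hsum]
  congr 1
  · congr 1
    · congr 1
      · rw [Finset.sum_comm]
        simp only [hF.apply_eq ρ, map_sum]
        simp only [hE.apply_eq]
      · rw [Finset.sum_comm]
        simp only [hE.apply_eq, Matrix.sum_mul]
    · rw [Finset.sum_comm]
      simp only [hE.apply_eq, Matrix.mul_sum]
  · simp only [hE.apply_eq ρ, map_sum]
    simp only [hF.apply_eq]

/-! ### Pauli channels and the maps C₊ and C₋ -/

theorem pauli_conjTranspose (i : Fin 4) : (pauli i)ᴴ = pauli i := by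
  fin_cases i <;> ext x y <;> fin_cases x <;> fin_cases y <;> simp [pauli]

theorem pauli_mul_self (i : Fin 4) : pauli i * pauli i = 1 := by
  fin_cases i <;> ext x y <;> fin_cases x <;> fin_cases y <;> simp [pauli, mul_apply]

theorem trace_conjMap_pauli (i : Fin 4) (ρ : Matrix (Fin 2) (Fin 2) ℂ) :
    (conjMap (pauli i) ρ).trace = ρ.trace := by
  rw [conjMap_apply, Matrix.trace_mul_comm, ← Matrix.mul_assoc, pauli_conjTranspose,
    pauli_mul_self, one_mul]

theorem conjMap_pauli_one (ρ : Matrix (Fin 2) (Fin 2) ℂ) :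
    conjMap (pauli 1) ρ = !![ρ 1 1, ρ 1 0; ρ 0 1, ρ 0 0] := by
  ext x y
  fin_cases x <;> fin_cases y <;> simp [conjMap_apply, pauli, mul_apply, vecMul, dotProduct]

theorem conjMap_pauli_two (ρ : Matrix (Fin 2) (Fin 2) ℂ) :
    conjMap (pauli 2) ρ = !![ρ 1 1, -ρ 1 0; -ρ 0 1, ρ 0 0] := by
  ext x y
  fin_cases x <;> fin_cases y <;> simp [conjMap_apply, pauli, mul_apply, vecMul, dotProduct] <;>
    ring_nf <;> rw [Complex.I_sq] <;> ring

theorem conjMap_pauli_three (ρ : Matrix (Fin 2) (Fin 2) ℂ) :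
    conjMap (pauli 3) ρ = !![ρ 0 0, -ρ 0 1; -ρ 1 0, ρ 1 1] := by
  ext x y
  fin_cases x <;> fin_cases y <;> simp [conjMap_apply, pauli, mul_apply, vecMul, dotProduct]

theorem pauliChannel_apply (p : Fin 4 → ℝ) (ρ : Matrix (Fin 2) (Fin 2) ℂ) :
    pauliChannel p ρ = (p 0 : ℂ) • ρ + (p 1 : ℂ) • conjMap (pauli 1) ρ +
      (p 2 : ℂ) • conjMap (pauli 2) ρ + (p 3 : ℂ) • conjMap (pauli 3) ρ := by
  have : conjMap (pauli 0) ρ = ρ := by simp [conjMap_apply, pauli]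
  simp [pauliChannel, Fin.sum_univ_four, this]

theorem isChannel_pauliChannel {p : Fin 4 → ℝ} (hp : p ∈ stdSimplex ℝ (Fin 4)) :
    IsChannel (pauliChannel p) := by
  refine (IsKrausSum.sum (P := fun _ => True) _ fun i _ =>
    IsKrausSum.smul (fun _ _ _ => trivial) (IsKrausSum.of_conjMap trivial)
      (by exact_mod_cast hp.1 i)).isChannel fun ρ => ?_
  have h : (∑ i, (p i : ℂ)) = 1 := by exact_mod_cast hp.2
  simp only [LinearMap.sum_apply, LinearMap.smul_apply, trace_sum, trace_smul,
    trace_conjMap_pauli, ← Finset.sum_smul, h, one_smul]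

theorem isKrausRep_pauliKraus {p : Fin 4 → ℝ} (hp : p ∈ stdSimplex ℝ (Fin 4)) :
    IsKrausRep (pauliKraus p) (pauliChannel p) := by
  have h : (∑ i, (p i : ℂ)) = 1 := by exact_mod_cast hp.2
  have hs : ∀ i, ((√(p i) : ℝ) : ℂ) * ((√(p i) : ℝ) : ℂ) = p i := fun i => by
    rw [← Complex.ofReal_mul, Real.mul_self_sqrt (hp.1 i)]
  constructor
  · simp only [pauliKraus, conjTranspose_smul, pauli_conjTranspose, Matrix.smul_mul,
      Matrix.mul_smul, smul_smul, pauli_mul_self, RCLike.star_def, Complex.conj_ofReal, hs,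
      ← Finset.sum_smul, h, one_smul]
  · intro ρ
    simp only [pauliChannel, LinearMap.sum_apply, smul_conjMap (hp.1 _), conjMap_apply, pauliKraus]

theorem qMinus_nonneg {p : Fin 4 → ℝ} (hp : p ∈ stdSimplex ℝ (Fin 4)) : 0 ≤ qMinus p := by
  have := hp.1
  have h1 := mul_nonneg (this 1) (this 2)
  have h2 := mul_nonneg (this 2) (this 3)
  have h3 := mul_nonneg (this 3) (this 1)
  unfold qMinus
  linarith

theorem qPlus_eq {p : Fin 4 → ℝ} (hp : p ∈ stdSimplex ℝ (Fin 4)) :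
    qPlus p = p 0 ^ 2 + p 1 ^ 2 + p 2 ^ 2 + p 3 ^ 2 + 2 * p 0 * (p 1 + p 2 + p 3) := by
  have h := hp.2
  rw [Fin.sum_univ_four] at h
  have h2 : (p 0 + p 1 + p 2 + p 3) ^ 2 = 1 := by rw [h]; norm_num
  unfold qPlus qMinus
  linarith

theorem qPlus_pos {p : Fin 4 → ℝ} (hp : p ∈ stdSimplex ℝ (Fin 4)) : 0 < qPlus p := by
  have h := hp.2
  rw [Fin.sum_univ_four] at h
  have h0 := hp.1
  rw [qPlus_eq hp]
  have h1 := mul_nonneg (h0 0) (add_nonneg (add_nonneg (h0 1) (h0 2)) (h0 3))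
  -- Centring at the uniform distribution bounds the sum of squares below by `1/4`.
  nlinarith [sq_nonneg (p 0 - 1 / 4), sq_nonneg (p 1 - 1 / 4), sq_nonneg (p 2 - 1 / 4),
    sq_nonneg (p 3 - 1 / 4)]

theorem isChannel_cPlus {p : Fin 4 → ℝ} (hp : p ∈ stdSimplex ℝ (Fin 4)) :
    IsChannel (cPlus p) := by
  have h0 : ∀ i, (0 : ℂ) ≤ p i := fun i => by exact_mod_cast hp.1 i
  have hc : ∀ i, IsKrausSum (fun _ => True) (conjMap (pauli i)) := fun i =>
    IsKrausSum.of_conjMap trivial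
  have hs : ∀ {Φ : OpMap (Fin 2) (Fin 2)} {t : ℂ}, IsKrausSum (fun _ => True) Φ → 0 ≤ t →
      IsKrausSum (fun _ => True) (t • Φ) := fun h ht => h.smul (fun _ _ _ => trivial) ht
  have hid : IsKrausSum (fun _ => True) (LinearMap.id : OpMap (Fin 2) (Fin 2)) := by
    rw [← conjMap_id]; exact IsKrausSum.of_conjMap trivial
  have hq := qPlus_pos hp
  refine IsKrausSum.isChannel (P := fun _ => True) (hs (.add (hs hid ?_) (hs (.add (.add
    (hs (hc 1) (h0 1)) (hs (hc 2) (h0 2))) (hs (hc 3) (h0 3))) ?_)) ?_) fun ρ => ?_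
  · rw [Complex.zero_le_real]; positivity
  · exact mul_nonneg zero_le_two (h0 0)
  · rw [← Complex.ofReal_inv, Complex.zero_le_real]; positivity
  · have h1 : ((qPlus p : ℝ) : ℂ) ≠ 0 := by exact_mod_cast hq.ne'
    simp only [cPlus, LinearMap.smul_apply, LinearMap.add_apply, LinearMap.id_apply, trace_smul,
      trace_add, trace_conjMap_pauli, smul_eq_mul]
    rw [inv_mul_eq_iff_eq_mul₀ h1, qPlus_eq hp]
    push_cast
    ring

theorem isChannel_cMinus {p : Fin 4 → ℝ} (hp : p ∈ stdSimplex ℝ (Fin 4)) (hq : qMinus p ≠ 0) :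
    IsChannel (cMinus p) := by
  have h0 : ∀ i j, (0 : ℂ) ≤ 2 * p i * p j := fun i j => by
    exact_mod_cast mul_nonneg (mul_nonneg zero_le_two (hp.1 i)) (hp.1 j)
  have hc : ∀ i, IsKrausSum (fun _ => True) (conjMap (pauli i)) := fun i =>
    IsKrausSum.of_conjMap trivial
  have hs : ∀ {Φ : OpMap (Fin 2) (Fin 2)} {t : ℂ}, IsKrausSum (fun _ => True) Φ → 0 ≤ t →
      IsKrausSum (fun _ => True) (t • Φ) := fun h ht => h.smul (fun _ _ _ => trivial) ht
  refine IsKrausSum.isChannel (P := fun _ => True) (hs (.add (.add (hs (hc 3) (h0 1 2))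
    (hs (hc 1) (h0 2 3))) (hs (hc 2) (h0 1 3))) ?_) fun ρ => ?_
  · rw [← Complex.ofReal_inv, Complex.zero_le_real]
    exact inv_nonneg.2 (qMinus_nonneg hp)
  · have h1 : ((qMinus p : ℝ) : ℂ) ≠ 0 := by exact_mod_cast hq
    simp only [cMinus, LinearMap.smul_apply, LinearMap.add_apply, trace_smul,
      trace_add, trace_conjMap_pauli, smul_eq_mul]
    rw [inv_mul_eq_iff_eq_mul₀ h1, qMinus]
    push_cast
    ring

theorem qPlus_smul_cPlus {p : Fin 4 → ℝ} (hp : p ∈ stdSimplex ℝ (Fin 4))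
    (ρ : Matrix (Fin 2) (Fin 2) ℂ) :
    (qPlus p : ℂ) • cPlus p ρ = ((p 0 ^ 2 + p 1 ^ 2 + p 2 ^ 2 + p 3 ^ 2 : ℝ) : ℂ) • ρ +
      (2 * p 0 : ℂ) • ((p 1 : ℂ) • conjMap (pauli 1) ρ + (p 2 : ℂ) • conjMap (pauli 2) ρ +
        (p 3 : ℂ) • conjMap (pauli 3) ρ) := by
  have h1 : ((qPlus p : ℝ) : ℂ) ≠ 0 := by exact_mod_cast (qPlus_pos hp).ne'
  rw [cPlus, LinearMap.smul_apply, smul_smul, mul_inv_cancel₀ h1, one_smul]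
  rfl

/-- It also holds for `q₋ = 0`: then the left side is zero, and each of the three nonnegative
products in `q₋` vanishes. -/
theorem qMinus_smul_cMinus {p : Fin 4 → ℝ} (hp : p ∈ stdSimplex ℝ (Fin 4))
    (ρ : Matrix (Fin 2) (Fin 2) ℂ) :
    (qMinus p : ℂ) • cMinus p ρ = (2 * p 1 * p 2 : ℂ) • conjMap (pauli 3) ρ +
      (2 * p 2 * p 3 : ℂ) • conjMap (pauli 1) ρ + (2 * p 1 * p 3 : ℂ) • conjMap (pauli 2) ρ := by
  rcases eq_or_ne (qMinus p) 0 with h | h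
  · have h1 := mul_nonneg (hp.1 1) (hp.1 2)
    have h2 := mul_nonneg (hp.1 2) (hp.1 3)
    have h3 := mul_nonneg (hp.1 1) (hp.1 3)
    have h4 := h
    unfold qMinus at h4
    have e1 : (2 * p 1 * p 2 : ℂ) = 0 := by
      have : 2 * p 1 * p 2 = 0 := by nlinarith
      exact_mod_cast this
    have e2 : (2 * p 2 * p 3 : ℂ) = 0 := by
      have : 2 * p 2 * p 3 = 0 := by nlinarith
      exact_mod_cast this
    have e3 : (2 * p 1 * p 3 : ℂ) = 0 := by
      have : 2 * p 1 * p 3 = 0 := by nlinarith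
      exact_mod_cast this
    rw [h, e1, e2, e3]
    simp
  · have h1 : ((qMinus p : ℝ) : ℂ) ≠ 0 := by exact_mod_cast h
    rw [cMinus, LinearMap.smul_apply, smul_smul, mul_inv_cancel₀ h1, one_smul]
    rfl

theorem pauliChannel_pauliChannel (p : Fin 4 → ℝ) (ρ : Matrix (Fin 2) (Fin 2) ℂ) :
    pauliChannel p (pauliChannel p ρ) =
      (((p 0 ^ 2 + p 1 ^ 2 + p 2 ^ 2 + p 3 ^ 2 : ℝ) : ℂ) • ρ +
      (2 * p 0 : ℂ) • ((p 1 : ℂ) • conjMap (pauli 1) ρ + (p 2 : ℂ) • conjMap (pauli 2) ρ +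
        (p 3 : ℂ) • conjMap (pauli 3) ρ)) + ((2 * p 1 * p 2 : ℂ) • conjMap (pauli 3) ρ +
      (2 * p 2 * p 3 : ℂ) • conjMap (pauli 1) ρ + (2 * p 1 * p 3 : ℂ) • conjMap (pauli 2) ρ) := by
  ext x y
  fin_cases x <;> fin_cases y <;>
    simp [pauliChannel_apply, conjMap_pauli_one, conjMap_pauli_two, conjMap_pauli_three] <;> ring

/-- An off-diagonal block is a sum of `σᵢ σⱼ ρ σᵢ σⱼ` with weights `p i * p j`. Compared with `σᵢ σⱼ
ρ σⱼ σᵢ` in `pauliChannel_pauliChannel`, only the anticommuting pairs, those of distinct nontrivial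
Pauli matrices, change sign. -/
theorem sum_pauliChannel_mul {p : Fin 4 → ℝ} (hp : p ∈ stdSimplex ℝ (Fin 4))
    (ρ : Matrix (Fin 2) (Fin 2) ℂ) :
    ∑ j, pauliChannel p (pauliKraus p j * ρ) * (pauliKraus p j)ᴴ =
      (((p 0 ^ 2 + p 1 ^ 2 + p 2 ^ 2 + p 3 ^ 2 : ℝ) : ℂ) • ρ +
      (2 * p 0 : ℂ) • ((p 1 : ℂ) • conjMap (pauli 1) ρ + (p 2 : ℂ) • conjMap (pauli 2) ρ +
        (p 3 : ℂ) • conjMap (pauli 3) ρ)) - ((2 * p 1 * p 2 : ℂ) • conjMap (pauli 3) ρ +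
      (2 * p 2 * p 3 : ℂ) • conjMap (pauli 1) ρ + (2 * p 1 * p 3 : ℂ) • conjMap (pauli 2) ρ) := by
  have hs : ∀ i, ((√(p i) : ℝ) : ℂ) * ((√(p i) : ℝ) : ℂ) = p i := fun i => by
    rw [← Complex.ofReal_mul, Real.mul_self_sqrt (hp.1 i)]
  have h : ∀ j, pauliChannel p (pauliKraus p j * ρ) * (pauliKraus p j)ᴴ =
      (p j : ℂ) • (pauliChannel p (pauli j * ρ) * pauli j) := fun j => by
    simp only [pauliKraus, conjTranspose_smul, pauli_conjTranspose, Matrix.smul_mul, map_smul,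
      Matrix.mul_smul, smul_smul, RCLike.star_def, Complex.conj_ofReal, hs]
  simp only [h]
  rw [eta_fin_two ρ]
  generalize ρ 0 0 = a, ρ 0 1 = b, ρ 1 0 = c, ρ 1 1 = d
  simp only [Fin.sum_univ_four, pauliChannel_apply, conjMap_pauli_one, conjMap_pauli_two,
    conjMap_pauli_three]
  ext x y
  fin_cases x <;> fin_cases y <;> simp [pauli] <;> ring_nf <;>
    simp only [Complex.I_sq] <;> ring

theorem sum_mul_pauliChannel {p : Fin 4 → ℝ} (hp : p ∈ stdSimplex ℝ (Fin 4))
    (ρ : Matrix (Fin 2) (Fin 2) ℂ) :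
    ∑ j, pauliKraus p j * pauliChannel p (ρ * (pauliKraus p j)ᴴ) =
      (((p 0 ^ 2 + p 1 ^ 2 + p 2 ^ 2 + p 3 ^ 2 : ℝ) : ℂ) • ρ +
      (2 * p 0 : ℂ) • ((p 1 : ℂ) • conjMap (pauli 1) ρ + (p 2 : ℂ) • conjMap (pauli 2) ρ +
        (p 3 : ℂ) • conjMap (pauli 3) ρ)) - ((2 * p 1 * p 2 : ℂ) • conjMap (pauli 3) ρ +
      (2 * p 2 * p 3 : ℂ) • conjMap (pauli 1) ρ + (2 * p 1 * p 3 : ℂ) • conjMap (pauli 2) ρ) := by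
  have hs : ∀ i, ((√(p i) : ℝ) : ℂ) * ((√(p i) : ℝ) : ℂ) = p i := fun i => by
    rw [← Complex.ofReal_mul, Real.mul_self_sqrt (hp.1 i)]
  have h : ∀ j, pauliKraus p j * pauliChannel p (ρ * (pauliKraus p j)ᴴ) =
      (p j : ℂ) • (pauli j * pauliChannel p (ρ * pauli j)) := fun j => by
    simp only [pauliKraus, conjTranspose_smul, pauli_conjTranspose, Matrix.smul_mul, map_smul,
      Matrix.mul_smul, smul_smul, RCLike.star_def, Complex.conj_ofReal, hs]
  simp only [h]
  rw [eta_fin_two ρ]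
  generalize ρ 0 0 = a, ρ 0 1 = b, ρ 1 0 = c, ρ 1 1 = d
  simp only [Fin.sum_univ_four, pauliChannel_apply, conjMap_pauli_one, conjMap_pauli_two,
    conjMap_pauli_three]
  ext x y
  fin_cases x <;> fin_cases y <;> simp [pauli] <;> ring_nf <;>
    simp only [Complex.I_sq] <;> ring

/-! ### Capacity from a flat Choi state -/

/-- The `n`-fold tensor power of a matrix. -/
noncomputable def Matrix.tensorPow {c : Type*} (T : Matrix c c ℂ) (n : ℕ) :
    Matrix (Fin n → c) (Fin n → c) ℂ :=
  Matrix.of fun f g => ∏ k, T (f k) (g k)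

theorem Matrix.tensorPow_mul_self {c : Type*} [Fintype c] {T : Matrix c c ℂ} {s : ℂ}
    (h : T * T = s • T) (n : ℕ) : T.tensorPow n * T.tensorPow n = s ^ n • T.tensorPow n := by
  classical
  ext f g
  have h1 : ∀ k, ∑ x, T (f k) x * T x (g k) = s * T (f k) (g k) := fun k => by
    rw [← mul_apply, h]; rfl
  simp only [mul_apply, tensorPow, of_apply, ← Finset.prod_mul_distrib, Matrix.smul_apply,
    smul_eq_mul]
  have h2 := Finset.prod_univ_sum (fun _ : Fin n => (Finset.univ : Finset c))
      (fun k x => T (f k) x * T x (g k))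
  rw [Fintype.piFinset_univ] at h2
  rw [← h2]
  simp only [h1, Finset.prod_mul_distrib, Finset.prod_const, Finset.card_univ, Fintype.card_fin]

/-- The state obtained by applying `I ⊗ Φ` to a maximally entangled state. -/
noncomputable def choiState {a b : Type*} [Fintype a] [DecidableEq a] (Φ : OpMap a b) :
    Matrix (a × b) (a × b) ℂ :=
  Matrix.of fun p q => (Fintype.card a : ℂ)⁻¹ * Φ (Matrix.single p.1 q.1 1) p.2 q.2

theorem traceFst_tensorPow {a b : Type*} [Fintype a] (T : Matrix (a × b) (a × b) ℂ) (n : ℕ) :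
    traceFst ((T.tensorPow n).submatrix (fun (p : (Fin n → a) × (Fin n → b)) k => (p.1 k, p.2 k))
      (fun p k => (p.1 k, p.2 k))) = (traceFst T).tensorPow n := by
  classical
  ext x y
  have h2 := Finset.prod_univ_sum (fun _ : Fin n => (Finset.univ : Finset a))
      (fun k i => T (i, x k) (i, y k))
  rw [Fintype.piFinset_univ] at h2
  simp only [traceFst, tensorPow, of_apply, submatrix_apply]
  exact h2.symm

/-- A channel whose normalised Choi state and its reduction are proportional to projections with
suitable ranks has the largest capacity allowed by the dimension of the input. -/
theorem hasQuantumCapacity_logb_card {a b : Type*} [Fintype a] [DecidableEq a] [Nonempty a]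
    [Fintype b] [DecidableEq b] {Φ : OpMap a b} (hΦ : IsChannel Φ) {s r : ℝ} (hr : 0 < r)
    (hs : choiState Φ * choiState Φ = (s : ℂ) • choiState Φ)
    (hB : traceFst (choiState Φ) * traceFst (choiState Φ) = (r : ℂ) • traceFst (choiState Φ))
    (hsr : s = r * Fintype.card a) : HasQuantumCapacity Φ (Real.logb 2 (Fintype.card a)) := by
  have hcard : (0 : ℝ) < Fintype.card a := by exact_mod_cast Fintype.card_pos
  have hs0 : 0 < s := hsr ▸ mul_pos hr hcard
  refine ⟨fun n => n * Real.logb 2 (Fintype.card a), fun n => ⟨?_, ?_⟩, ?_⟩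
  -- The maximally entangled state on `n` copies attains the bound.
  · let v : (Fin n → a) × (Fin n → a) → ℂ := fun p => if p.1 = p.2 then 1 else 0
    have hc0 : (Fintype.card a : ℂ) ≠ 0 := by exact_mod_cast Fintype.card_ne_zero
    have hρ : IsDensity (((Fintype.card a : ℂ)⁻¹ ^ n) • vecMulVec v (star v)) := by
      constructor
      · refine (posSemidef_vecMulVec_self_star v).smul ?_
        simp
      · rw [trace_smul, trace_vecMulVec]
        simp only [dotProduct, Fintype.sum_prod_type, v]
        simp [hc0]
    have hτ := (hΦ.tensorPower n).isDensity_ampliation hρ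
    -- Up to regrouping the indices as pairs of strings, the output is the tensor power of the Choi
    -- state.
    have e : ampliation (Fin n → a) (tensorPower Φ n)
        (((Fintype.card a : ℂ)⁻¹ ^ n) • vecMulVec v (star v)) =
        ((choiState Φ).tensorPow n).submatrix (fun p k => (p.1 k, p.2 k))
          (fun p k => (p.1 k, p.2 k)) := by
      ext p q
      rw [map_smul, Matrix.smul_apply, ampliation_apply]
      have h1 : (Matrix.of fun x y => vecMulVec v (star v) (p.1, x) (q.1, y)) =
          Matrix.single p.1 q.1 (1 : ℂ) := by
        ext x y
        simp only [of_apply, vecMulVec_apply, v, single_apply, Pi.star_apply]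
        by_cases h1 : p.1 = x <;> by_cases h2 : q.1 = y <;> simp [h1, h2]
      rw [h1, tensorPower_apply, Finset.sum_eq_single p.1, Finset.sum_eq_single q.1]
      · simp only [single_apply_same, one_mul, submatrix_apply, tensorPow, of_apply, choiState,
          Finset.prod_mul_distrib, Finset.prod_const, Finset.card_univ, Fintype.card_fin,
          smul_eq_mul]
      · intro j _ hj; simp [hj.symm]
      · simp
      · intro i _ hi; simp [hi.symm]
      · simp
    refine ⟨_, hρ, ?_⟩
    set τ := ampliation (Fin n → a) (tensorPower Φ n)
        (((Fintype.card a : ℂ)⁻¹ ^ n) • vecMulVec v (star v))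
    have hττ : τ * τ = ((s ^ n : ℝ) : ℂ) • τ := by
      rw [e]
      have := submatrix_mul_equiv ((choiState Φ).tensorPow n) ((choiState Φ).tensorPow n)
        (fun (p : (Fin n → a) × (Fin n → b)) k => (p.1 k, p.2 k))
        (Equiv.arrowProdEquivProdArrow (Fin n) (fun _ => a) (fun _ => b)).symm
        (fun (p : (Fin n → a) × (Fin n → b)) k => (p.1 k, p.2 k))
      refine this.trans ?_
      rw [Matrix.tensorPow_mul_self hs, Complex.ofReal_pow]
      rfl
    have hBB : traceFst τ * traceFst τ = ((r ^ n : ℝ) : ℂ) • traceFst τ := by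
      rw [e, traceFst_tensorPow, Matrix.tensorPow_mul_self hB, Complex.ofReal_pow]
    -- The two entropies are `-n log₂ r` for the receiver and `-n log₂ s` jointly; their difference
    -- is `n log₂ (s / r)`.
    rw [stateCoherentInfo, vonNeumannEntropy_of_mul_self hτ.1.1 hτ.2 hττ,
      vonNeumannEntropy_of_mul_self (traceFst_posSemidef hτ.1).1
        ((trace_traceFst τ).trans hτ.2) hBB, Real.logb_pow, Real.logb_pow, hsr,
      Real.logb_mul hr.ne' hcard.ne']
    ring
  · rintro x ⟨ρ, hρ, rfl⟩
    have := (hΦ.tensorPower n).stateCoherentInfo_le_logb_card hρ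
    simpa [Real.logb_pow] using this
  · refine tendsto_const_nhds.congr' ?_
    filter_upwards [Filter.eventually_ge_atTop 1] with n hn
    have : (n : ℝ) ≠ 0 := by positivity
    field_simp

/-- A qubit channel that applies `Z` or not with equal probabilities, and records this in a
perfectly distinguishable way, has capacity one. -/
theorem hasQuantumCapacity_one_of_flagged {Φ : OpMap (Fin 2) (Fin 2 × Fin 2)} (hΦ : IsChannel Φ)
    {α β : Matrix (Fin 2) (Fin 2) ℂ} (hα : α * α = α) (hβ : β * β = β) (hαβ : α * β = 0)
    (hβα : β * α = 0) (h1 : α + β = 1)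
    (h : ∀ ρ, Φ ρ = (1 / 2 : ℂ) • (ρ ⊗ₖ α) + (1 / 2 : ℂ) • ((pauli 3 * ρ * pauli 3) ⊗ₖ β)) :
    HasQuantumCapacity Φ 1 := by
  -- `v` and `w` are the matrices `1` and `Z` written as vectors, each of squared norm two; the Choi
  -- state is a quarter of `|v⟩⟨v| ⊗ α + |w⟩⟨w| ⊗ β`.
  let v : Fin 2 × Fin 2 → ℂ := fun p => if p.1 = p.2 then 1 else 0
  let w : Fin 2 × Fin 2 → ℂ := fun p => pauli 3 p.1 p.2
  let e : Fin 2 × (Fin 2 × Fin 2) ≃ (Fin 2 × Fin 2) × Fin 2 := (Equiv.prodAssoc _ _ _).symm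
  have hv : vecMulVec v v * vecMulVec v v = (2 : ℂ) • vecMulVec v v := by
    rw [vecMulVec_mul_vecMulVec]
    simp [v, dotProduct, Fintype.sum_prod_type]
  have hw : vecMulVec w w * vecMulVec w w = (2 : ℂ) • vecMulVec w w := by
    rw [vecMulVec_mul_vecMulVec]
    simp [w, dotProduct, Fintype.sum_prod_type, pauli]
    norm_num
  have hz : ∀ i j x y, (pauli 3 * Matrix.single i j (1 : ℂ) * pauli 3 : Matrix (Fin 2) (Fin 2) ℂ) x y =
      pauli 3 x i * pauli 3 j y := by
    intro i j x y
    simp [mul_apply, single_apply, ite_and]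
  have hzs : ∀ i j, pauli 3 i j = pauli 3 j i := by
    intro i j
    fin_cases i <;> fin_cases j <;> rfl
  have hC : choiState Φ = (1 / 4 : ℂ) •
      (vecMulVec v v ⊗ₖ α + vecMulVec w w ⊗ₖ β).submatrix e e := by
    ext ⟨i, x, c⟩ ⟨j, y, d⟩
    simp only [choiState, of_apply, h, Matrix.add_apply, Matrix.smul_apply, kroneckerMap_apply,
      hz, smul_eq_mul, submatrix_apply, vecMulVec_apply, e, Equiv.prodAssoc_symm_apply, v, w,
      Fintype.card_fin, single_apply, hzs x i]
    by_cases h1 : i = x <;> by_cases h2 : j = y <;> simp [h1, h2] <;> ring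
  have hT : traceFst (choiState Φ) = (1 / 4 : ℂ) • 1 := by
    ext ⟨x, c⟩ ⟨y, d⟩
    have h2 : ∀ i, choiState Φ (i, (x, c)) (i, (y, d)) = (1 / 4 : ℂ) *
        ((if i = x then 1 else 0) * (if i = y then 1 else 0) * α c d +
          pauli 3 x i * pauli 3 i y * β c d) := by
      intro i
      rw [hC]
      simp only [Matrix.add_apply, Matrix.smul_apply, kroneckerMap_apply,
        smul_eq_mul, submatrix_apply, vecMulVec_apply, e, Equiv.prodAssoc_symm_apply, v, w, hzs i x]
    have h3 : ∑ i, pauli 3 x i * pauli 3 i y = (1 : Matrix (Fin 2) (Fin 2) ℂ) x y := by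
      rw [← pauli_mul_self 3, mul_apply]
    rw [traceFst, of_apply]
    simp only [h2, ← Finset.mul_sum, Finset.sum_add_distrib, ← Finset.sum_mul, h3]
    have h4 : ∑ i, (if i = x then (1 : ℂ) else 0) * (if i = y then 1 else 0) =
      (1 : Matrix (Fin 2) (Fin 2) ℂ) x y := by simp [one_apply, eq_comm]
    rw [h4, ← mul_add, ← Matrix.add_apply, h1, Matrix.smul_apply, smul_eq_mul, ← one_kronecker_one,
      kroneckerMap_apply]
  -- The flags remove the cross terms, so squaring gives the factor `2 / 4 = 1/2`. The marginal is
  -- maximally mixed in dimension four, whence `r = 1/4`.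
  have := hasQuantumCapacity_logb_card hΦ (s := 1 / 2) (r := 1 / 4) (by norm_num) ?_ ?_
    (by norm_num)
  · simpa using this
  · rw [hC, Matrix.smul_mul, Matrix.mul_smul, submatrix_mul_equiv]
    simp only [Matrix.add_mul, Matrix.mul_add, ← mul_kronecker_mul, hv, hw, hα, hβ, hαβ, hβα,
      kronecker_zero, add_zero, zero_add, smul_kronecker]
    rw [← smul_add, submatrix_smul, Pi.smul_apply, Pi.smul_apply, smul_smul, smul_smul, smul_smul]
    norm_num
  · rw [hT, Matrix.smul_mul, one_mul]
    norm_num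

/-! ### The channel `channelXY` is entanglement-breaking -/

theorem channelXY_apply (ρ : Matrix (Fin 2) (Fin 2) ℂ) :
    channelXY ρ = ρ 0 0 • Matrix.single 1 1 1 + ρ 1 1 • Matrix.single 0 0 1 := by
  have : channelXY ρ = (1 / 2 : ℂ) • (conjMap (pauli 1) ρ + conjMap (pauli 2) ρ) := rfl
  rw [this, conjMap_pauli_one, conjMap_pauli_two]
  ext x y
  fin_cases x <;> fin_cases y <;> simp <;> ring

theorem channelXY_eq_pauliChannel : channelXY = pauliChannel ![0, 1 / 2, 1 / 2, 0] := by
  refine LinearMap.ext fun ρ => ?_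
  have : channelXY ρ = (1 / 2 : ℂ) • (conjMap (pauli 1) ρ + conjMap (pauli 2) ρ) := rfl
  rw [this, pauliChannel_apply]
  simp

theorem mem_stdSimplex_XY : (![0, 1 / 2, 1 / 2, 0] : Fin 4 → ℝ) ∈ stdSimplex ℝ (Fin 4) := by
  constructor
  · intro i
    fin_cases i <;> norm_num
  · simp [Fin.sum_univ_four]
    norm_num

theorem isChannel_channelXY : IsChannel channelXY :=
  channelXY_eq_pauliChannel ▸ isChannel_pauliChannel mem_stdSimplex_XY

/-- The Kraus operators `X` and `Y`, scaled, have rank two. The measure-and-reprepare form supplies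
the rank-one ones `|1⟩⟨0|` and `|0⟩⟨1|`. -/
theorem isKrausSum_isRankOne_channelXY : IsKrausSum IsRankOne channelXY := by
  have h : channelXY = conjMap (Matrix.single 1 0 1) + conjMap (Matrix.single 0 1 1) := by
    refine LinearMap.ext fun ρ => ?_
    rw [channelXY_apply, LinearMap.add_apply, conjMap_apply, conjMap_apply]
    simp
  rw [h]
  exact (IsKrausSum.of_conjMap ⟨_, _, single_eq_single_vecMulVec_single 1 0⟩).add
    (IsKrausSum.of_conjMap ⟨_, _, single_eq_single_vecMulVec_single 0 1⟩)

theorem isDensity_single {a : Type*} [Fintype a] [DecidableEq a] (i : a) :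
    IsDensity (Matrix.single i i (1 : ℂ)) := by
  refine ⟨?_, trace_single_eq_same _ _⟩
  rw [← diagonal_single]
  refine PosSemidef.diagonal ?_
  rw [Pi.single_nonneg]
  exact zero_le_one

/-- Normalisation by the trace; a positive semidefinite matrix of trace zero vanishes, and then any
state serves. -/
theorem Matrix.PosSemidef.exists_isDensity {a : Type*} [Fintype a] [Nonempty a]
    {σ : Matrix a a ℂ} (h : σ.PosSemidef) :
    ∃ q : ℝ, 0 ≤ q ∧ σ.trace = q ∧ ∃ α, IsDensity α ∧ σ = (q : ℂ) • α := by
  classical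
  obtain ⟨h1, h2⟩ := Complex.nonneg_iff.1 h.trace_nonneg
  have ht : σ.trace = ((σ.trace.re : ℝ) : ℂ) := Complex.ext rfl (by simp [← h2])
  refine ⟨σ.trace.re, h1, ht, ?_⟩
  rcases h1.eq_or_lt with h0 | h0
  · obtain ⟨i⟩ := ‹Nonempty a›
    refine ⟨_, isDensity_single i, ?_⟩
    rw [← h0] at ht ⊢
    rw [Complex.ofReal_zero, h.trace_eq_zero_iff] at ht
    rw [ht]
    simp
  · have hne : ((σ.trace.re : ℝ) : ℂ) ≠ 0 := by exact_mod_cast h0.ne'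
    refine ⟨((σ.trace.re : ℝ) : ℂ)⁻¹ • σ, ⟨h.smul ?_, ?_⟩, ?_⟩
    · rw [← Complex.ofReal_inv, Complex.zero_le_real]
      exact (inv_pos.2 h0).le
    · rw [trace_smul, smul_eq_mul]
      conv_lhs => rw [ht]
      simp [hne]
    · rw [smul_smul, mul_inv_cancel₀ hne, one_smul]

/-- The two diagonal blocks of `ρ` along the qubit are the unnormalised states of the reference,
each paired with the flipped basis state. Their traces are the weights and add up to `Tr ρ = 1`. -/
theorem isEntanglementBreaking_channelXY : IsEntanglementBreaking channelXY := by
  refine ⟨isChannel_channelXY, fun k ρ hρ => ?_⟩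
  have : Nonempty (Fin k) := by
    by_contra hne
    rw [not_nonempty_iff] at hne
    have := hρ.2
    rw [Matrix.trace_eq_zero_of_isEmpty] at this
    exact zero_ne_one this
  obtain ⟨q₀, hq₀, ht₀, α₀, hα₀, h₀⟩ :=
    (hρ.1.submatrix (fun i => (i, (0 : Fin 2)))).exists_isDensity
  obtain ⟨q₁, hq₁, ht₁, α₁, hα₁, h₁⟩ :=
    (hρ.1.submatrix (fun i => (i, (1 : Fin 2)))).exists_isDensity
  refine ⟨2, ![q₀, q₁], ![α₀, α₁], ![Matrix.single 1 1 1, Matrix.single 0 0 1], ⟨?_, ?_⟩, ?_, ?_, ?_⟩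
  · intro i
    fin_cases i
    exacts [hq₀, hq₁]
  · rw [Fin.sum_univ_two]
    have h2 := hρ.2
    simp only [Matrix.trace, diag_apply, Fintype.sum_prod_type, Fin.sum_univ_two,
      Finset.sum_add_distrib] at h2
    simp only [Matrix.trace, diag_apply, submatrix_apply] at ht₀ ht₁
    rw [ht₀, ht₁] at h2
    exact_mod_cast h2
  · intro i
    fin_cases i
    exacts [hα₀, hα₁]
  · intro i
    fin_cases i
    exacts [isDensity_single 1, isDensity_single 0]
  · rw [Fin.sum_univ_two]
    simp only [cons_val_zero, cons_val_one, ← smul_kronecker, ← h₀, ← h₁]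
    ext p q
    rw [ampliation_apply, channelXY_apply]
    rfl

/-! ### Two-way assistance -/

/-- Kronecker products of two matrices. -/
def IsKroneckerProduct {a b c d : Type*} (K : Matrix (a × b) (c × d) ℂ) : Prop :=
  ∃ (A : Matrix a c ℂ) (B : Matrix b d ℂ), K = A ⊗ₖ B

theorem IsKroneckerProduct.mul {a b c d e f : Type*} [Fintype c] [Fintype d]
    {K : Matrix (a × b) (c × d) ℂ} {L : Matrix (c × d) (e × f) ℂ} (hK : IsKroneckerProduct K)
    (hL : IsKroneckerProduct L) : IsKroneckerProduct (K * L) := by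
  obtain ⟨A, B, rfl⟩ := hK
  obtain ⟨C, D, rfl⟩ := hL
  exact ⟨A * C, B * D, (mul_kronecker_mul _ _ _ _).symm⟩

theorem trace_sum_comp_conjMap {a b c ι : Type*} [Fintype a] [DecidableEq a] [Fintype b]
    [Fintype c] [Fintype ι] {Φ : ι → OpMap b c} {K : ι → Matrix b a ℂ}
    (hΦ : ∀ i ρ, (Φ i ρ).trace = ρ.trace) (hK : ∑ i, (K i)ᴴ * K i = 1) (ρ : Matrix a a ℂ) :
    ((∑ i, Φ i ∘ₗ conjMap (K i)) ρ).trace = ρ.trace := by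
  have h : ∀ i, (K i * ρ * (K i)ᴴ).trace = ((K i)ᴴ * K i * ρ).trace := fun i => by
    rw [Matrix.trace_mul_comm, Matrix.mul_assoc]
  simp only [LinearMap.sum_apply, LinearMap.comp_apply, trace_sum, hΦ, conjMap_apply, h]
  rw [← trace_sum, ← Matrix.sum_mul, hK, one_mul]

theorem sendQubit_apply (E : OpMap (Fin 2) (Fin 2)) (a b : ℕ)
    (τ : Matrix (Fin (a * 2) × Fin b) (Fin (a * 2) × Fin b) ℂ) (p q : Fin a × Fin (b * 2)) :
    sendQubit E a b τ p q =
      E (Matrix.of fun u v => τ (finProdFinEquiv (p.1, u), (finProdFinEquiv.symm p.2).1)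
        (finProdFinEquiv (q.1, v), (finProdFinEquiv.symm q.2).1))
        (finProdFinEquiv.symm p.2).2 (finProdFinEquiv.symm q.2).2 := rfl

/-- One use amounts to the sender measuring the qubit, by `A c`, and the receiver appending the
flipped basis state, by `B`; both Kraus operators are therefore local products. -/
theorem isKrausSum_sendQubit_channelXY (a b : ℕ) :
    IsKrausSum IsKroneckerProduct (sendQubit channelXY a b) := by
  let A : Fin 2 → Matrix (Fin a) (Fin (a * 2)) ℂ := fun c =>
    Matrix.of fun x z => if finProdFinEquiv (x, c) = z then 1 else 0
  let B : Fin 2 → Matrix (Fin (b * 2)) (Fin b) ℂ := fun c =>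
    Matrix.of fun z y => if (finProdFinEquiv.symm z).1 = y ∧ (finProdFinEquiv.symm z).2 = c
      then 1 else 0
  have h : sendQubit channelXY a b = conjMap (A 0 ⊗ₖ B 1) + conjMap (A 1 ⊗ₖ B 0) := by
    refine LinearMap.ext fun τ => ?_
    ext ⟨x, z⟩ ⟨x', z'⟩
    obtain ⟨⟨y, c⟩, rfl⟩ := finProdFinEquiv.surjective z
    obtain ⟨⟨y', c'⟩, rfl⟩ := finProdFinEquiv.surjective z'
    have key : ∀ i j, conjMap (A i ⊗ₖ B j) τ (x, finProdFinEquiv (y, c))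
        (x', finProdFinEquiv (y', c')) = τ (finProdFinEquiv (x, i), y) (finProdFinEquiv (x', i), y')
          * Matrix.single j j 1 c c' := by
      intro i j
      simp only [conjMap_apply, mul_apply, Fintype.sum_prod_type, kroneckerMap_apply, A, B,
        of_apply, conjTranspose_apply, Equiv.symm_apply_apply, ite_and, mul_ite, ite_mul,
        apply_ite (star : ℂ → ℂ), star_one, star_zero, one_mul, mul_one, zero_mul, mul_zero,
        Finset.sum_ite_eq, Finset.mem_univ, if_true, single_apply, Finset.sum_ite_irrel,
        Finset.sum_const_zero]
      rcases eq_or_ne c j with rfl | h1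
      · rcases eq_or_ne c' c with rfl | h2
        · simp
        · simp [h2, h2.symm]
      · simp [h1, h1.symm]
    rw [LinearMap.add_apply, Matrix.add_apply, key, key]
    refine (sendQubit_apply _ _ _ _ _ _).trans ?_
    rw [channelXY_apply, Matrix.add_apply]
    simp
  rw [h]
  exact (IsKrausSum.of_conjMap ⟨_, _, rfl⟩).add (IsKrausSum.of_conjMap ⟨_, _, rfl⟩)

theorem trace_sendQubit {E : OpMap (Fin 2) (Fin 2)} (hE : ∀ ρ, (E ρ).trace = ρ.trace) (a b : ℕ)
    (τ : Matrix (Fin (a * 2) × Fin b) (Fin (a * 2) × Fin b) ℂ) :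
    (sendQubit E a b τ).trace = τ.trace := by
  have h := fun x y => hE (Matrix.of fun u v => τ (finProdFinEquiv (x, u), y)
    (finProdFinEquiv (x, v), y))
  simp only [Matrix.trace, diag_apply, of_apply] at h
  simp only [Matrix.trace, diag_apply, Fintype.sum_prod_type, sendQubit_apply]
  rw [← finProdFinEquiv.sum_comp (fun z => ∑ y, τ (z, y) (z, y)), Fintype.sum_prod_type]
  refine Finset.sum_congr rfl fun x _ => ?_
  rw [← finProdFinEquiv.sum_comp, Fintype.sum_prod_type]
  simp only [Equiv.symm_apply_apply, h]
  exact Finset.sum_comm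

/-- Induction over the protocol: local measurements have product Kraus operators, products compose
to products, and by hypothesis a channel use brings nothing else. -/
theorem TwoWayProtocol.isKrausSum_isKroneckerProduct {E : OpMap (Fin 2) (Fin 2)}
    (hE : ∀ ρ, (E ρ).trace = ρ.trace)
    (hsend : ∀ a b, IsKrausSum IsKroneckerProduct (sendQubit E a b)) {n a b a' b' : ℕ}
    {Φ : OpMap (Fin a × Fin b) (Fin a' × Fin b')} (h : TwoWayProtocol E n a b a' b' Φ) :
    IsKrausSum IsKroneckerProduct Φ ∧ ∀ ρ, (Φ ρ).trace = ρ.trace := by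
  induction h with
  | done n a b =>
    refine ⟨?_, fun _ => rfl⟩
    rw [← conjMap_id]
    exact IsKrausSum.of_conjMap ⟨1, 1, one_kronecker_one.symm⟩
  | sender A hA Φ hΦ ih =>
    refine ⟨IsKrausSum.sum _ fun k _ => (ih k).1.comp (fun _ _ => IsKroneckerProduct.mul)
      (IsKrausSum.of_conjMap ⟨A k, 1, rfl⟩), trace_sum_comp_conjMap (fun k => (ih k).2) ?_⟩
    simp only [conjTranspose_kronecker, ← mul_kronecker_mul, conjTranspose_one, one_mul]
    rw [← one_kronecker_one, ← hA]
    ext p q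
    simp [Matrix.sum_apply, Finset.sum_mul]
  | receiver B hB Φ hΦ ih =>
    refine ⟨IsKrausSum.sum _ fun k _ => (ih k).1.comp (fun _ _ => IsKroneckerProduct.mul)
      (IsKrausSum.of_conjMap ⟨1, B k, rfl⟩), trace_sum_comp_conjMap (fun k => (ih k).2) ?_⟩
    simp only [conjTranspose_kronecker, ← mul_kronecker_mul, conjTranspose_one, one_mul]
    rw [← one_kronecker_one, ← hB]
    ext p q
    simp [Matrix.sum_apply, Finset.mul_sum]
  | use Φ hΦ ih =>
    refine ⟨ih.1.comp (fun _ _ => IsKroneckerProduct.mul) (hsend _ _), fun ρ => ?_⟩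
    rw [LinearMap.comp_apply, ih.2, trace_sendQubit hE]

theorem conjMap_ketbra {a b : Type*} [Fintype a] (K : Matrix b a ℂ) (v : a → ℂ) :
    conjMap K (ketbra v) = ketbra (K *ᵥ v) := by
  rw [conjMap_apply, ketbra, ketbra, mul_vecMulVec, vecMulVec_mul, star_mulVec]

theorem star_dotProduct_ketbra_mulVec {a : Type*} [Fintype a] (v w : a → ℂ) :
    (star w ⬝ᵥ ketbra v *ᵥ w).re = ‖star w ⬝ᵥ v‖ ^ 2 := by
  rw [ketbra, vecMulVec_mulVec, dotProduct_smul]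
  have : star v ⬝ᵥ w = star (star w ⬝ᵥ v) := Matrix.star_dotProduct v w
  rw [this]
  simp only [MulOpposite.smul_eq_mul_unop, MulOpposite.unop_op]
  rw [RCLike.star_def, Complex.mul_conj', ← Complex.ofReal_pow, Complex.ofReal_re]

theorem trace_ketbra {a : Type*} [Fintype a] (v : a → ℂ) :
    (ketbra v).trace = ((∑ i, ‖v i‖ ^ 2 : ℝ) : ℂ) := by
  rw [ketbra, trace_vecMulVec, dotProduct, Complex.ofReal_sum]
  refine Finset.sum_congr rfl fun i _ => ?_
  rw [Pi.star_apply, RCLike.star_def, Complex.mul_conj', Complex.ofReal_pow]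

/-- In Bloch coordinates the left side is `(p + q)(r + s)` plus half the inner product of the planar
vectors `(p - q, X)` and `(r - s, Y)`. Their lengths are at most `p + q` and `r + s`, so
Cauchy–Schwarz yields the factor `3/2`. -/
theorem norm_sq_mutually_unbiased_le (a₀ a₁ b₀ b₁ : ℂ) :
    ‖a₀‖ ^ 2 * ‖b₀‖ ^ 2 + ‖a₁‖ ^ 2 * ‖b₁‖ ^ 2 + ‖a₀ + a₁‖ ^ 2 * ‖b₀ + b₁‖ ^ 2 / 4 +
      ‖a₀ - a₁‖ ^ 2 * ‖b₀ - b₁‖ ^ 2 / 4 ≤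
    3 / 2 * ((‖a₀‖ ^ 2 + ‖a₁‖ ^ 2) * (‖b₀‖ ^ 2 + ‖b₁‖ ^ 2)) := by
  have key : ∀ u v : ℂ, ∃ X : ℝ, ‖u + v‖ ^ 2 = ‖u‖ ^ 2 + ‖v‖ ^ 2 + X ∧
      ‖u - v‖ ^ 2 = ‖u‖ ^ 2 + ‖v‖ ^ 2 - X ∧ X ^ 2 ≤ 4 * (‖u‖ ^ 2 * ‖v‖ ^ 2) := by
    intro u v
    refine ⟨2 * (u.re * v.re + u.im * v.im), ?_, ?_, ?_⟩
    · simp only [Complex.sq_norm, Complex.normSq_apply, Complex.add_re, Complex.add_im]; ring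
    · simp only [Complex.sq_norm, Complex.normSq_apply, Complex.sub_re, Complex.sub_im]; ring
    · simp only [Complex.sq_norm, Complex.normSq_apply]
      nlinarith [sq_nonneg (u.re * v.im - u.im * v.re)]
  obtain ⟨X, hX1, hX2, hX⟩ := key a₀ a₁
  obtain ⟨Y, hY1, hY2, hY⟩ := key b₀ b₁
  rw [hX1, hX2, hY1, hY2]
  have p0 := sq_nonneg ‖a₀‖
  have q0 := sq_nonneg ‖a₁‖
  have r0 := sq_nonneg ‖b₀‖
  have s0 := sq_nonneg ‖b₁‖
  generalize ‖a₀‖ ^ 2 = p at *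
  generalize ‖a₁‖ ^ 2 = q at *
  generalize ‖b₀‖ ^ 2 = r at *
  generalize ‖b₁‖ ^ 2 = s at *
  have h1 : (p - q) ^ 2 + X ^ 2 ≤ (p + q) ^ 2 := by nlinarith
  have h2 : (r - s) ^ 2 + Y ^ 2 ≤ (r + s) ^ 2 := by nlinarith
  have h3 : ((p - q) * (r - s) + X * Y) ^ 2 ≤ ((p + q) * (r + s)) ^ 2 := by
    have e1 : ((p - q) * (r - s) + X * Y) ^ 2 ≤
        ((p - q) ^ 2 + X ^ 2) * ((r - s) ^ 2 + Y ^ 2) := by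
      nlinarith [sq_nonneg ((p - q) * Y - X * (r - s))]
    have e2 := mul_le_mul h1 h2 (by positivity) (by positivity)
    rw [mul_pow]
    exact e1.trans e2
  have h4 := abs_le_of_sq_le_sq' h3 (by positivity)
  nlinarith [h4.2]

theorem not_isTwoWayAchievable_of_pos {E : OpMap (Fin 2) (Fin 2)}
    (hE : ∀ ρ, (E ρ).trace = ρ.trace)
    (hsend : ∀ a b, IsKrausSum IsKroneckerProduct (sendQubit E a b)) {R : ℝ} (hR : 0 < R) :
    ¬ IsTwoWayAchievable E R := by
  intro h
  -- Four fidelities of at least `7/8` add up to more than the bound `3` proved below. The choice `n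
  -- ≥ 1 / R` ensures `D ≥ 2`, so that there is a plane to test on.
  obtain ⟨N, hN⟩ := h (1 / 8) (by norm_num)
  obtain ⟨D, Φ, hD, hprot, hfid⟩ := hN (max N ⌈1 / R⌉₊) (le_max_left _ _)
  have hD2 : 2 ≤ D := by
    have h1 : 1 ≤ ((max N ⌈1 / R⌉₊ : ℕ) : ℝ) * R := by
      rw [← div_le_iff₀ hR]
      exact (Nat.le_ceil _).trans (by exact_mod_cast le_max_right _ _)
    have h2 := (Real.rpow_le_rpow_of_exponent_le one_le_two h1).trans hD
    rw [Real.rpow_one] at h2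
    exact_mod_cast h2
  obtain ⟨⟨ι, _, K, hK, rfl⟩, htr⟩ := hprot.isKrausSum_isKroneckerProduct hE hsend
  choose A B hAB using hK
  -- As `A l` is a row and `B l` a column, `K l` has rank one: `f` is its measurement amplitude on
  -- `ψ`, and `g` the overlap of `ψ` with the prepared vector.
  let f : ι → (Fin D → ℂ) → ℂ := fun l ψ => ∑ z, A l 0 z * ψ z
  let g : ι → (Fin D → ℂ) → ℂ := fun l ψ => ∑ w, star (ψ w) * B l w 0
  have hKψ : ∀ l (ψ : Fin D → ℂ), (K l *ᵥ fun z : Fin D × Fin 1 => ψ z.1) =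
      fun p => B l p.2 0 * f l ψ := by
    intro l ψ
    ext ⟨x, w⟩
    simp only [mulVec, dotProduct, hAB, kroneckerMap_apply, Fintype.sum_prod_type,
      Finset.univ_unique, Finset.sum_singleton, f, Finset.mul_sum, Fin.default_eq_zero,
      Fin.isValue, Subsingleton.elim x 0]
    exact Finset.sum_congr rfl fun z _ => by ring
  have hF : ∀ ψ : Fin D → ℂ, (star (fun z : Fin 1 × Fin D => ψ z.2) ⬝ᵥ
      ((∑ l, conjMap (K l)) (ketbra fun z : Fin D × Fin 1 => ψ z.1) *ᵥ fun z => ψ z.2)).re =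
      ∑ l, ‖f l ψ‖ ^ 2 * ‖g l ψ‖ ^ 2 := by
    intro ψ
    simp only [LinearMap.sum_apply, conjMap_ketbra, Matrix.sum_mulVec, dotProduct_sum,
      Complex.re_sum, star_dotProduct_ketbra_mulVec]
    refine Finset.sum_congr rfl fun l _ => ?_
    rw [hKψ, ← mul_pow, ← norm_mul]
    congr 2
    simp only [dotProduct, Fintype.sum_prod_type, Finset.univ_unique, Finset.sum_singleton, g,
      Finset.mul_sum, Pi.star_apply]
    exact Finset.sum_congr rfl fun z _ => by ring
  -- Trace preservation on a basis state normalises the total weight.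
  have hT : ∀ z : Fin D, ∑ l, ‖A l 0 z‖ ^ 2 * ∑ w, ‖B l w 0‖ ^ 2 = 1 := by
    intro z
    have h1 := htr (ketbra fun p : Fin D × Fin 1 => (Pi.single z 1 : Fin D → ℂ) p.1)
    have h2 : ∀ l, f l (Pi.single z 1) = A l 0 z := fun l => by simp [f, Pi.single_apply]
    simp only [LinearMap.sum_apply, conjMap_ketbra, trace_sum, trace_ketbra, hKψ, h2,
      Fintype.sum_prod_type, Finset.univ_unique, Finset.sum_singleton, norm_mul, mul_pow] at h1
    have h3 : ∑ x : Fin D, ‖(Pi.single z 1 : Fin D → ℂ) x‖ ^ 2 = 1 := by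
      rw [Finset.sum_eq_single z]
      · simp
      · intro x _ hx; simp [hx]
      · simp
    rw [h3] at h1
    have h4 : ∑ l, ∑ w, ‖B l w 0‖ ^ 2 * ‖A l 0 z‖ ^ 2 = 1 := by exact_mod_cast h1
    rw [← h4]
    exact Finset.sum_congr rfl fun l _ => by rw [mul_comm, Finset.sum_mul]
  let i₀ : Fin D := ⟨0, by omega⟩
  let i₁ : Fin D := ⟨1, by omega⟩
  have hne : i₀ ≠ i₁ := by simp [i₀, i₁]
  let c : ℂ := ((√2 : ℝ) : ℂ)⁻¹
  have hcc : star c * c = 1 / 2 := by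
    simp only [c, RCLike.star_def, map_inv₀, Complex.conj_ofReal]
    rw [← mul_inv, ← Complex.ofReal_mul, Real.mul_self_sqrt zero_le_two]
    norm_num
  have hcn : ‖c‖ ^ 2 = 1 / 2 := by
    have := Complex.conj_mul' c
    rw [← RCLike.star_def, hcc] at this
    have h2 : ((‖c‖ ^ 2 : ℝ) : ℂ) = ((1 / 2 : ℝ) : ℂ) := by push_cast; exact this.symm
    exact_mod_cast h2
  -- At `t = 1` and `t = -1` these vectors form a basis of the plane unbiased to that of `i₀` and
  -- `i₁`.
  let ψ : ℂ → Fin D → ℂ := fun t => c • (Pi.single i₀ 1 + t • Pi.single i₁ 1)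
  have hψ : ∀ t : ℂ, star t * t = 1 → star (ψ t) ⬝ᵥ ψ t = 1 := by
    intro t ht
    simp only [ψ, star_smul, star_add, smul_dotProduct, dotProduct_smul, add_dotProduct,
      dotProduct_add, smul_eq_mul, ← Pi.single_star, star_one]
    simp [hne, hne.symm]
    rw [← RCLike.star_def]
    linear_combination 2 * hcc + c * star c * ht
  have hfψ : ∀ l t, f l (ψ t) = c * (A l 0 i₀ + t * A l 0 i₁) := by
    intro l t
    simp [f, ψ, mul_add, Finset.sum_add_distrib, Pi.single_apply]
    ring
  have hgψ : ∀ l t, g l (ψ t) = star c * (B l i₀ 0 + star t * B l i₁ 0) := by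
    intro l t
    simp [g, ψ, mul_add, add_mul, Finset.sum_add_distrib, Pi.single_apply,
      apply_ite (starRingEnd ℂ)]
    ring
  have hf0 : ∀ l i, f l (Pi.single i 1) = A l 0 i := fun l i => by simp [f, Pi.single_apply]
  have hg0 : ∀ l i, g l (Pi.single i 1) = B l i 0 := fun l i => by
    simp [g, Pi.single_apply, apply_ite (starRingEnd ℂ)]
  have F0 := hfid (Pi.single i₀ 1) (by simp)
  have F1 := hfid (Pi.single i₁ 1) (by simp)
  have F2 := hfid (ψ 1) (hψ 1 (by simp))
  have F3 := hfid (ψ (-1)) (hψ (-1) (by simp))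
  rw [hF] at F0 F1 F2 F3
  simp only [hf0, hg0] at F0 F1
  simp only [hfψ, hgψ, star_one, star_neg, one_mul, neg_mul, ← sub_eq_add_neg, norm_mul, norm_star,
    mul_pow, hcn] at F2 F3
  have hsum : ∑ l, (‖A l 0 i₀‖ ^ 2 * ‖B l i₀ 0‖ ^ 2 + ‖A l 0 i₁‖ ^ 2 * ‖B l i₁ 0‖ ^ 2 +
      1 / 2 * ‖A l 0 i₀ + A l 0 i₁‖ ^ 2 * (1 / 2 * ‖B l i₀ 0 + B l i₁ 0‖ ^ 2) +
      1 / 2 * ‖A l 0 i₀ - A l 0 i₁‖ ^ 2 * (1 / 2 * ‖B l i₀ 0 - B l i₁ 0‖ ^ 2)) ≤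
      ∑ l, 3 / 2 * (‖A l 0 i₀‖ ^ 2 * ∑ w, ‖B l w 0‖ ^ 2 +
        ‖A l 0 i₁‖ ^ 2 * ∑ w, ‖B l w 0‖ ^ 2) := by
    refine Finset.sum_le_sum fun l _ => ?_
    have h1 := norm_sq_mutually_unbiased_le (A l 0 i₀) (A l 0 i₁) (B l i₀ 0) (B l i₁ 0)
    have h2 : ‖B l i₀ 0‖ ^ 2 + ‖B l i₁ 0‖ ^ 2 ≤ ∑ w, ‖B l w 0‖ ^ 2 := by
      rw [← Finset.sum_pair hne (f := fun w => ‖B l w 0‖ ^ 2)]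
      exact Finset.sum_le_sum_of_subset_of_nonneg (Finset.subset_univ _)
        fun _ _ _ => sq_nonneg _
    have h3 := mul_le_mul_of_nonneg_left h2
      (add_nonneg (sq_nonneg ‖A l 0 i₀‖) (sq_nonneg ‖A l 0 i₁‖))
    linarith
  simp only [Finset.sum_add_distrib, ← Finset.mul_sum, hT] at hsum
  linarith

theorem isTwoWayAchievable_zero (E : OpMap (Fin 2) (Fin 2)) : IsTwoWayAchievable E 0 := by
  refine fun ε hε => ⟨0, fun n _ => ⟨1, LinearMap.id, by simp, .done n 1 1, fun ψ hψ => ?_⟩⟩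
  have h : star (fun z : Fin 1 × Fin 1 => ψ z.2) ⬝ᵥ (fun z : Fin 1 × Fin 1 => ψ z.1) = 1 := by
    rw [← hψ]
    simp [dotProduct, Fintype.sum_prod_type]
  rw [LinearMap.id_apply, star_dotProduct_ketbra_mulVec, h]
  simp [hε.le]

theorem hasTwoWayQuantumCapacity_zero {E : OpMap (Fin 2) (Fin 2)}
    (hE : ∀ ρ, (E ρ).trace = ρ.trace)
    (hsend : ∀ a b, IsKrausSum IsKroneckerProduct (sendQubit E a b)) :
    HasTwoWayQuantumCapacity E 0 :=
  IsGreatest.isLUB ⟨isTwoWayAchievable_zero E, fun _ hR =>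
    not_lt.1 fun h => not_isTwoWayAchievable_of_pos hE hsend h hR⟩

/-! ### The SWITCH of two Pauli channels -/

theorem conjMap_pauli_apply (i : Fin 4) (ρ : Matrix (Fin 2) (Fin 2) ℂ) :
    conjMap (pauli i) ρ = pauli i * ρ * pauli i := by
  rw [conjMap_apply, pauli_conjTranspose]

theorem switchMap_pauliChannel {p : Fin 4 → ℝ} (hp : p ∈ stdSimplex ℝ (Fin 4)) {r s : ℕ}
    {E : Fin r → Matrix (Fin 2) (Fin 2) ℂ} {F : Fin s → Matrix (Fin 2) (Fin 2) ℂ}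
    (hE : IsKrausRep E (pauliChannel p)) (hF : IsKrausRep F (pauliChannel p))
    (ω ρ : Matrix (Fin 2) (Fin 2) ℂ) :
    switchMap E F ω ρ = (qPlus p : ℂ) • (cPlus p ρ ⊗ₖ ω) +
      (qMinus p : ℂ) • (cMinus p ρ ⊗ₖ (pauli 3 * ω * pauli 3)) := by
  have hK := isKrausRep_pauliKraus hp
  have h1 : ∑ j, pauliChannel p (F j * ρ) * (F j)ᴴ =
      ∑ j, pauliChannel p (pauliKraus p j * ρ) * (pauliKraus p j)ᴴ := by
    -- Expanding the outer channel in Pauli operators and folding the `G j` back into the channel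
    -- leaves an expression free of `G`; so any Kraus family may be replaced by the Pauli one.
    have : ∀ {n : ℕ} {G : Fin n → Matrix (Fin 2) (Fin 2) ℂ}, IsKrausRep G (pauliChannel p) →
        ∑ j, pauliChannel p (G j * ρ) * (G j)ᴴ =
          ∑ i, pauliKraus p i * pauliChannel p (ρ * (pauliKraus p i)ᴴ) := by
      intro n G hG
      simp only [hK.apply_eq, Matrix.sum_mul]
      rw [Finset.sum_comm]
      refine Finset.sum_congr rfl fun i _ => ?_
      rw [← hK.apply_eq, hG.apply_eq, Matrix.mul_sum]
      simp only [Matrix.mul_assoc]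
    rw [this hF, this hK]
  have h2 : ∑ j, F j * pauliChannel p (ρ * (F j)ᴴ) =
      ∑ j, pauliKraus p j * pauliChannel p (ρ * (pauliKraus p j)ᴴ) := by
    have : ∀ {n : ℕ} {G : Fin n → Matrix (Fin 2) (Fin 2) ℂ}, IsKrausRep G (pauliChannel p) →
        ∑ j, G j * pauliChannel p (ρ * (G j)ᴴ) =
          ∑ i, pauliChannel p (pauliKraus p i * ρ) * (pauliKraus p i)ᴴ := by
      intro n G hG
      simp only [hK.apply_eq (ρ * _), Matrix.mul_sum]
      rw [Finset.sum_comm]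
      refine Finset.sum_congr rfl fun i _ => ?_
      rw [hG.apply_eq, Matrix.sum_mul]
      simp only [Matrix.mul_assoc]
    rw [this hF, this hK]
  rw [switchMap_apply_eq hE hF, h1, h2, sum_pauliChannel_mul hp, sum_mul_pauliChannel hp,
    pauliChannel_pauliChannel, ← qPlus_smul_cPlus hp, ← qMinus_smul_cMinus hp,
    ← conjMap_pauli_apply, conjMap_pauli_three]
  generalize cPlus p ρ = S
  generalize cMinus p ρ = T
  ext ⟨x, c⟩ ⟨y, d⟩
  fin_cases c <;> fin_cases d <;> simp <;> ring

theorem isChannel_switchMap_pauliChannel {p : Fin 4 → ℝ} (hp : p ∈ stdSimplex ℝ (Fin 4)) {r s : ℕ}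
    {E : Fin r → Matrix (Fin 2) (Fin 2) ℂ} {F : Fin s → Matrix (Fin 2) (Fin 2) ℂ}
    (hE : IsKrausRep E (pauliChannel p)) (hF : IsKrausRep F (pauliChannel p))
    {ω : Matrix (Fin 2) (Fin 2) ℂ} (hω : IsDensity ω) : IsChannel (switchMap E F ω) := by
  refine (isKrausSum_switchMap E F hω.1).isChannel fun ρ => ?_
  have h1 : (pauli 3 * ω * pauli 3).trace = 1 := by
    rw [← conjMap_pauli_apply, trace_conjMap_pauli, hω.2]
  rw [switchMap_pauliChannel hp hE hF, trace_add, trace_smul, trace_smul, trace_kronecker,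
    trace_kronecker, hω.2, h1, (isChannel_cPlus hp).tracePreserving]
  have h2 : (qMinus p : ℂ) • ((cMinus p ρ).trace * 1) = (qMinus p : ℂ) • (ρ.trace * 1) := by
    rcases eq_or_ne (qMinus p) 0 with h | h
    · simp [h]
    · rw [(isChannel_cMinus hp h).tracePreserving]
  rw [h2, ← add_smul, qPlus]
  simp

/-! ### Measuring the control in the basis |+⟩, |-⟩ -/

theorem exists_fourierKet_eq : ∃ c : ℂ, star c = c ∧ c * c = 1 / 2 ∧ fourierKet 0 = ![c, c] ∧
    fourierKet 1 = ![c, -c] := by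
  refine ⟨((√2 : ℝ) : ℂ)⁻¹, ?_, ?_, rfl, rfl⟩
  · rw [← Complex.ofReal_inv]
    exact Complex.conj_ofReal _
  · rw [← mul_inv, ← Complex.ofReal_mul, Real.mul_self_sqrt zero_le_two]
    norm_num

theorem ketbra_fourierKet_zero : ketbra (fourierKet 0) = !![1 / 2, 1 / 2; 1 / 2, 1 / 2] := by
  obtain ⟨c, hc, hcc, h0, h1⟩ := exists_fourierKet_eq
  rw [RCLike.star_def] at hc
  rw [h0, ketbra]
  ext x y
  rw [vecMulVec_apply, Pi.star_apply]
  fin_cases x <;> fin_cases y <;> simpa [hc] using hcc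

theorem ketbra_fourierKet_one : ketbra (fourierKet 1) = !![1 / 2, -(1 / 2); -(1 / 2), 1 / 2] := by
  obtain ⟨c, hc, hcc, h0, h1⟩ := exists_fourierKet_eq
  rw [RCLike.star_def] at hc
  rw [h1, ketbra]
  ext x y
  rw [vecMulVec_apply, Pi.star_apply]
  fin_cases x <;> fin_cases y <;> simpa [hc] using hcc

theorem isDensity_ketbra_fourierKet_zero : IsDensity (ketbra (fourierKet 0)) := by
  refine ⟨posSemidef_vecMulVec_self_star _, ?_⟩
  rw [ketbra_fourierKet_zero, trace_fin_two]
  norm_num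

theorem controlOutcome_kronecker {d : Type*} (v : Fin 2 → ℂ) (α : Matrix d d ℂ)
    (β : Matrix (Fin 2) (Fin 2) ℂ) : controlOutcome v (α ⊗ₖ β) = (star v ⬝ᵥ β *ᵥ v) • α := by
  ext x y
  simp only [controlOutcome, LinearMap.coe_mk, AddHom.coe_mk, of_apply, kroneckerMap_apply,
    Matrix.smul_apply, smul_eq_mul, dotProduct, mulVec, Finset.mul_sum, Finset.sum_mul,
    Pi.star_apply]
  exact Finset.sum_congr rfl fun c _ => Finset.sum_congr rfl fun c' _ => by ring

theorem star_fourierKet_dotProduct (s t : Fin 2) :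
    star (fourierKet s) ⬝ᵥ ketbra (fourierKet t) *ᵥ fourierKet s = if s = t then 1 else 0 := by
  obtain ⟨c, hc, hcc, h0, h1⟩ := exists_fourierKet_eq
  rw [RCLike.star_def] at hc
  revert s t
  simp only [Fin.forall_fin_two, ketbra_fourierKet_zero, ketbra_fourierKet_one]
  simp only [h0, h1]
  refine ⟨⟨?_, ?_⟩, ?_, ?_⟩ <;> simp [dotProduct, mulVec, hc]
  · linear_combination 2 * hcc
  · linear_combination 2 * hcc

/-! ### Perfect activation -/

section

variable {r s : ℕ} {E : Fin r → Matrix (Fin 2) (Fin 2) ℂ} {F : Fin s → Matrix (Fin 2) (Fin 2) ℂ}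

theorem switchMap_channelXY (hE : IsKrausRep E channelXY) (hF : IsKrausRep F channelXY)
    (ρ : Matrix (Fin 2) (Fin 2) ℂ) :
    switchMap E F (ketbra (fourierKet 0)) ρ = (1 / 2 : ℂ) • (ρ ⊗ₖ ketbra (fourierKet 0)) +
      (1 / 2 : ℂ) • ((pauli 3 * ρ * pauli 3) ⊗ₖ ketbra (fourierKet 1)) := by
  rw [channelXY_eq_pauliChannel] at hE hF
  have hp := mem_stdSimplex_XY
  have h1 := qPlus_smul_cPlus hp ρ
  have h2 := qMinus_smul_cMinus hp ρ
  have h3 : pauli 3 * ketbra (fourierKet 0) * pauli 3 = ketbra (fourierKet 1) := by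
    rw [← conjMap_pauli_apply, conjMap_pauli_three, ketbra_fourierKet_zero, ketbra_fourierKet_one]
    simp
  rw [switchMap_pauliChannel hp hE hF, h3, ← smul_kronecker, ← smul_kronecker, h1, h2,
    conjMap_pauli_apply 3, ← smul_kronecker, ← smul_kronecker]
  congr 2
  · simp
    norm_num
  · simp

theorem controlOutcome_switchMap_channelXY (hE : IsKrausRep E channelXY)
    (hF : IsKrausRep F channelXY) (ρ : Matrix (Fin 2) (Fin 2) ℂ) :
    controlOutcome (fourierKet 0) (switchMap E F (ketbra (fourierKet 0)) ρ) = (1 / 2 : ℂ) • ρ ∧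
      controlOutcome (fourierKet 1) (switchMap E F (ketbra (fourierKet 0)) ρ) =
        (1 / 2 : ℂ) • (pauli 3 * ρ * pauli 3) := by
  rw [switchMap_channelXY hE hF]
  simp only [map_add, map_smul, controlOutcome_kronecker, star_fourierKet_dotProduct]
  simp

theorem measureControl_switchMap_channelXY (hE : IsKrausRep E channelXY)
    (hF : IsKrausRep F channelXY) (ρ : Matrix (Fin 2) (Fin 2) ℂ) :
    measureControl (switchMap E F (ketbra (fourierKet 0))) ρ =
      (1 / 2 : ℂ) • (ρ ⊗ₖ Matrix.single 0 0 1) +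
        (1 / 2 : ℂ) • ((pauli 3 * ρ * pauli 3) ⊗ₖ Matrix.single 1 1 1) := by
  have h : measureControl (switchMap E F (ketbra (fourierKet 0))) ρ =
    ∑ s, controlOutcome (fourierKet s) (switchMap E F (ketbra (fourierKet 0)) ρ) ⊗ₖ
      Matrix.single s s 1 := rfl
  obtain ⟨h0, h1⟩ := controlOutcome_switchMap_channelXY hE hF ρ
  rw [h, Fin.sum_univ_two, h0, h1, smul_kronecker, smul_kronecker]

theorem isChannel_measureControl_switchMap_channelXY (hE : IsKrausRep E channelXY)
    (hF : IsKrausRep F channelXY) :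
    IsChannel (measureControl (switchMap E F (ketbra (fourierKet 0)))) := by
  have h : measureControl (switchMap E F (ketbra (fourierKet 0))) =
      (1 / 2 : ℂ) • appendMap (Matrix.single 0 0 1) +
        (1 / 2 : ℂ) • (appendMap (Matrix.single 1 1 1) ∘ₗ conjMap (pauli 3)) := by
    refine LinearMap.ext fun ρ => ?_
    rw [measureControl_switchMap_channelXY hE hF, ← conjMap_pauli_apply]
    rfl
  have hhalf : (0 : ℂ) ≤ 1 / 2 := by
    rw [Complex.nonneg_iff]
    norm_num
  have hK : IsKrausSum (fun _ => True) (measureControl (switchMap E F (ketbra (fourierKet 0)))) := by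
    rw [h]
    exact ((isKrausSum_appendMap (isDensity_single 0).1).smul (fun _ _ _ => trivial) hhalf).add
      (((isKrausSum_appendMap (isDensity_single 1).1).comp (fun _ _ _ _ => trivial)
        (IsKrausSum.of_conjMap (P := fun _ => True) trivial)).smul (fun _ _ _ => trivial) hhalf)
  refine hK.isChannel fun ρ => ?_
  rw [measureControl_switchMap_channelXY hE hF, ← conjMap_pauli_apply, trace_add, trace_smul,
    trace_smul, trace_kronecker, trace_kronecker, trace_conjMap_pauli, trace_single_eq_same,
    trace_single_eq_same, ← add_smul]
  norm_num

/-- The receiver reads the flag and undoes `Z` when it shows the outcome `|-⟩`; `V s` selects the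
block with flag `s`. -/
theorem isCorrectable_measureControl_switchMap_channelXY (hE : IsKrausRep E channelXY)
    (hF : IsKrausRep F channelXY) :
    IsCorrectable (measureControl (switchMap E F (ketbra (fourierKet 0)))) := by
  let V : Fin 2 → Matrix (Fin 2) (Fin 2 × Fin 2) ℂ := fun s =>
    Matrix.of fun x p => if p = (x, s) then 1 else 0
  have hV : ∀ s (τ : Matrix (Fin 2 × Fin 2) (Fin 2 × Fin 2) ℂ),
      conjMap (V s) τ = τ.submatrix (fun x => (x, s)) (fun x => (x, s)) := by
    intro s τ
    ext x y
    simp [conjMap_apply, mul_apply, V, apply_ite (starRingEnd ℂ)]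
  let R : OpMap (Fin 2 × Fin 2) (Fin 2) :=
    conjMap (V 0) + conjMap (pauli 3) ∘ₗ conjMap (V 1)
  have hR : ∀ τ, R τ = conjMap (V 0) τ + conjMap (pauli 3) (conjMap (V 1) τ) := fun _ => rfl
  refine ⟨R, ?_, LinearMap.ext fun ρ => ?_⟩
  · refine ((IsKrausSum.of_conjMap (P := fun _ => True) trivial).add
      ((IsKrausSum.of_conjMap (P := fun _ => True) trivial).comp (fun _ _ _ _ => trivial)
        (IsKrausSum.of_conjMap (P := fun _ => True) trivial))).isChannel fun τ => ?_
    change (R τ).trace = τ.trace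
    rw [hR, trace_add, trace_conjMap_pauli, hV, hV]
    simp only [Matrix.trace, diag_apply, submatrix_apply, Fintype.sum_prod_type,
      Fin.sum_univ_two]
    ring
  · rw [LinearMap.comp_apply, LinearMap.id_apply, measureControl_switchMap_channelXY hE hF, hR, hV,
      hV]
    have h0 : ∀ (s : Fin 2) (A B : Matrix (Fin 2) (Fin 2) ℂ),
        ((1 / 2 : ℂ) • (A ⊗ₖ (Matrix.single 0 0 1 : Matrix (Fin 2) (Fin 2) ℂ)) +
          (1 / 2 : ℂ) • (B ⊗ₖ (Matrix.single 1 1 1 : Matrix (Fin 2) (Fin 2) ℂ))).submatrix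
          (fun x => (x, s)) (fun x => (x, s)) = (1 / 2 : ℂ) • if s = 0 then A else B := by
      intro s A B
      ext x y
      fin_cases s <;> simp
    rw [h0, h0, if_pos rfl, if_neg one_ne_zero, map_smul, conjMap_pauli_apply]
    have h1 : pauli 3 * (pauli 3 * ρ * pauli 3) * pauli 3 = ρ := by
      calc _ = (pauli 3 * pauli 3) * ρ * (pauli 3 * pauli 3) := by simp only [Matrix.mul_assoc]
        _ = ρ := by rw [pauli_mul_self, one_mul, mul_one]
    rw [h1, ← add_smul]
    norm_num

theorem hasQuantumCapacity_switchMap_channelXY (hE : IsKrausRep E channelXY)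
    (hF : IsKrausRep F channelXY) :
    HasQuantumCapacity (switchMap E F (ketbra (fourierKet 0))) 1 := by
  have h := switchMap_channelXY hE hF
  have hE' := hE
  have hF' := hF
  rw [channelXY_eq_pauliChannel] at hE' hF'
  refine hasQuantumCapacity_one_of_flagged (isChannel_switchMap_pauliChannel mem_stdSimplex_XY hE'
    hF' isDensity_ketbra_fourierKet_zero) (α := ketbra (fourierKet 0)) (β := ketbra (fourierKet 1))
    ?_ ?_ ?_ ?_ ?_ h
  all_goals
    simp only [ketbra_fourierKet_zero, ketbra_fourierKet_one]
    ext x y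
    fin_cases x <;> fin_cases y <;> simp <;> norm_num

theorem hasQuantumCapacity_measureControl_switchMap_channelXY (hE : IsKrausRep E channelXY)
    (hF : IsKrausRep F channelXY) :
    HasQuantumCapacity (measureControl (switchMap E F (ketbra (fourierKet 0)))) 1 := by
  refine hasQuantumCapacity_one_of_flagged (isChannel_measureControl_switchMap_channelXY hE hF)
    (α := Matrix.single 0 0 1) (β := Matrix.single 1 1 1) ?_ ?_ ?_ ?_ ?_
    (measureControl_switchMap_channelXY hE hF)
  · simp
  · simp
  · simp
  · simp
  · ext x y
    fin_cases x <;> fin_cases y <;> simp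

end

/-- Rank-one Kraus operators form a two-sided ideal under multiplication, so encoders and decoders
cannot restore any capacity. -/
theorem hasQuantumCapacity_zero_of_channelXY (m : ℕ) (a b : Type) [Fintype a] [DecidableEq a]
    [Nonempty a] [Fintype b] [DecidableEq b] (S : OpMap a (Fin m → Fin 2))
    (R : OpMap (Fin m → Fin 2) b) (hS : IsChannel S) (hR : IsChannel R) :
    HasQuantumCapacity (R ∘ₗ tensorPower channelXY m ∘ₗ S) 0 :=
  hasQuantumCapacity_zero_of_isRankOne (hR.comp ((isChannel_channelXY.tensorPower m).comp hS))
    (hR.isKrausSum.comp (fun L _ _ hK => hK.mul_left L)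
      ((isKrausSum_isRankOne_channelXY.tensorPower IsRankOne.tensorPower).comp
        (fun _ K hL _ => hL.mul_right K) hS.isKrausSum))

end

theorem mainTheorem6 :
    -- the SWITCH of two uses of a Pauli channel
    (∀ p : Fin 4 → ℝ, p ∈ stdSimplex ℝ (Fin 4) →
      IsChannel (pauliChannel p) ∧ IsKrausRep (pauliKraus p) (pauliChannel p) ∧
      0 ≤ qMinus p ∧ 0 < qPlus p ∧
      IsChannel (cPlus p) ∧ (qMinus p ≠ 0 → IsChannel (cMinus p)) ∧
      ∀ (r s : ℕ) (E : Fin r → Matrix (Fin 2) (Fin 2) ℂ) (F : Fin s → Matrix (Fin 2) (Fin 2) ℂ),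
        IsKrausRep E (pauliChannel p) → IsKrausRep F (pauliChannel p) →
        ∀ ω : Matrix (Fin 2) (Fin 2) ℂ, IsDensity ω →
          IsChannel (switchMap E F ω) ∧
          ∀ ρ : Matrix (Fin 2) (Fin 2) ℂ,
            switchMap E F ω ρ =
              (qPlus p : ℂ) • (cPlus p ρ ⊗ₖ ω) +
                (qMinus p : ℂ) • (cMinus p ρ ⊗ₖ (pauli 3 * ω * pauli 3))) ∧
    -- the channel `E_XY` is a Pauli channel of measure-and-reprepare form
    channelXY = pauliChannel ![0, 1 / 2, 1 / 2, 0] ∧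
    (∀ ρ : Matrix (Fin 2) (Fin 2) ℂ,
      channelXY ρ = ρ 0 0 • Matrix.single 1 1 1 + ρ 1 1 • Matrix.single 0 0 1) ∧
    -- it is entanglement-breaking and cannot transmit quantum information
    IsEntanglementBreaking channelXY ∧
    HasQuantumCapacity channelXY 0 ∧
    (∀ (m : ℕ) (a b : Type) [Fintype a] [DecidableEq a] [Nonempty a] [Fintype b] [DecidableEq b]
      (S : OpMap a (Fin m → Fin 2)) (R : OpMap (Fin m → Fin 2) b), IsChannel S → IsChannel R →
        HasQuantumCapacity (R ∘ₗ tensorPower channelXY m ∘ₗ S) 0) ∧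
    HasTwoWayQuantumCapacity channelXY 0 ∧
    -- two uses in the SWITCH, with the control in the state `|+⟩`
    (∀ (r s : ℕ) (E : Fin r → Matrix (Fin 2) (Fin 2) ℂ) (F : Fin s → Matrix (Fin 2) (Fin 2) ℂ),
      IsKrausRep E channelXY → IsKrausRep F channelXY →
        (∀ ρ : Matrix (Fin 2) (Fin 2) ℂ,
          switchMap E F (ketbra (fourierKet 0)) ρ =
            (1 / 2 : ℂ) • (ρ ⊗ₖ ketbra (fourierKet 0)) +
              (1 / 2 : ℂ) • ((pauli 3 * ρ * pauli 3) ⊗ₖ ketbra (fourierKet 1))) ∧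
        (∀ ρ : Matrix (Fin 2) (Fin 2) ℂ,
          controlOutcome (fourierKet 0) (switchMap E F (ketbra (fourierKet 0)) ρ) =
              (1 / 2 : ℂ) • ρ ∧
          controlOutcome (fourierKet 1) (switchMap E F (ketbra (fourierKet 0)) ρ) =
              (1 / 2 : ℂ) • (pauli 3 * ρ * pauli 3)) ∧
        IsChannel (measureControl (switchMap E F (ketbra (fourierKet 0)))) ∧
        IsCorrectable (measureControl (switchMap E F (ketbra (fourierKet 0)))) ∧
        HasQuantumCapacity (switchMap E F (ketbra (fourierKet 0))) 1 ∧
        HasQuantumCapacity (measureControl (switchMap E F (ketbra (fourierKet 0)))) 1) ∧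
    -- unit capacity is the maximum for a qubit input
    (∀ (b : Type) [Fintype b] [DecidableEq b] (Φ : OpMap (Fin 2) b), IsChannel Φ →
      ∀ Q : ℝ, HasQuantumCapacity Φ Q → Q ≤ 1) := by
  refine ⟨fun p hp => ⟨isChannel_pauliChannel hp, isKrausRep_pauliKraus hp, qMinus_nonneg hp,
    qPlus_pos hp, isChannel_cPlus hp, isChannel_cMinus hp, fun r s E F hE hF ω hω =>
      ⟨isChannel_switchMap_pauliChannel hp hE hF hω, switchMap_pauliChannel hp hE hF ω⟩⟩,
    channelXY_eq_pauliChannel, channelXY_apply, isEntanglementBreaking_channelXY,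
    hasQuantumCapacity_zero_of_isRankOne isChannel_channelXY isKrausSum_isRankOne_channelXY,
    hasQuantumCapacity_zero_of_channelXY,
    hasTwoWayQuantumCapacity_zero isChannel_channelXY.tracePreserving
      isKrausSum_sendQubit_channelXY,
    fun r s E F hE hF => ⟨switchMap_channelXY hE hF, controlOutcome_switchMap_channelXY hE hF,
      isChannel_measureControl_switchMap_channelXY hE hF,
      isCorrectable_measureControl_switchMap_channelXY hE hF,
      hasQuantumCapacity_switchMap_channelXY hE hF,
      hasQuantumCapacity_measureControl_switchMap_channelXY hE hF⟩,
    fun b _ _ Φ hΦ Q hQ => ?_⟩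
  simpa using hQ.le_logb_card hΦ
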